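/- Let $n\ge 1$ and $m\ge 0$ be integers, $A\in\mathbb{R}^{n\times n}$, $B\in\mathbb{R}^{n\times m}$, $K\in\mathbb{R}^{m\times n}$, and let $L=A+BK$ have spectral radius $\rho(L)<1$. Consider the closed-loop linear dynamics $$X_0=0,\qquad X_{k+1}=AX_k+BU_k+W_k,\qquad U_k=KX_k,\qquad k\ge 0,$$ where $W_0,W_1,\dots$ are i.i.d. $\mathcal N(0,I_n)$. Let $P_\infty$ be the unique solution of the Lyapunov equation $LP_\infty L^\top-P_\infty+I=0$. Let $\gamma\in(0,1)$, $\eta=\gamma/(1-\gamma)$, and $\phi(x)=\mathrm{svec}(xx^\top+\eta I)\in\mathbb{R}^{n(n+1)/2}$, where $\mathrm{svec}$ is the linear isometry from the symmetric $n\times n$ matrices (with the Frobenius inner product) to $\mathbb{R}^{n(n+1)/2}$ that lists the entries on and above the diagonal, the off-diagonal ones multiplied by $\sqrt2$. For $\rho\in(\rho(L),1)$ put $$\widetilde\Gamma=\Big(\sup_{|z|=1}\big\|(zI-\rho^{-1}L)^{-1}\big\|\Big)\sqrt{\mathrm{Tr}(P_\infty)+\frac{n}{1-\rho^2}},$$ where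 $\|\cdot\|$ is the spectral norm. There are universal constants $C,c>0$ such that, for all such $n,m,A,B,K,\gamma$, all $\rho\in(\rho(L),1)$, all $\delta\in(0,1)$ and all integers $N\ge 2$ with $$\frac{N}{\log(\widetilde\Gamma N/\delta)\,\log\log(\widetilde\Gamma N/\delta)}\;\ge\; C\,\frac{\max\{\mathrm{Tr}(P_\infty)^2,\ \eta^2 n\}}{(1-\rho)\,\lambda_{\min}^2(P_\infty)},$$ one has, with probability at least $1-\delta$, $$\lambda_{\min}\Big(\sum_{k=1}^N\phi(X_k)\phi(X_k)^\top\Big)\ \ge\ c\,N\,\lambda_{\min}^2(P_\infty).$$ -/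

import Mathlib

open MeasureTheory ProbabilityTheory
open scoped Matrix

noncomputable section

/-- The smallest eigenvalue `λ_min(M)` of a real symmetric matrix `M`. -/
def lambdaMin {ι : Type*} [Fintype ι] [DecidableEq ι] (M : Matrix ι ι ℝ) : ℝ :=
  sInf (spectrum ℝ M)

theorem lambdaMin_eq_iInf_eigenvalues {ι : Type*} [Fintype ι] [DecidableEq ι]
    {M : Matrix ι ι ℝ} (hM : M.IsHermitian) : lambdaMin M = ⨅ i, hM.eigenvalues i := by
  rw [lambdaMin, hM.spectrum_real_eq_range_eigenvalues, iInf]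

/-- A real matrix, viewed as a complex matrix. -/
def toComplexMatrix {n : ℕ} (M : Matrix (Fin n) (Fin n) ℝ) : Matrix (Fin n) (Fin n) ℂ :=
  M.map (algebraMap ℝ ℂ)

/-- The `H_∞` norm: the supremum over the unit circle of the spectral (`ℓ² → ℓ²` operator) norm. -/
def hinfNorm {n : ℕ} (G : ℂ → Matrix (Fin n) (Fin n) ℂ) : ℝ :=
  ⨆ z : Metric.sphere (0 : ℂ) 1, ‖Matrix.toEuclideanCLM (n := Fin n) (𝕜 := ℂ) (G z)‖

/-- The resolvent `Φ_M(z) = (z I - M)⁻¹` of a real square matrix, as a function on `ℂ`. -/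
def resolventFun {n : ℕ} (M : Matrix (Fin n) (Fin n) ℝ) : ℂ → Matrix (Fin n) (Fin n) ℂ :=
  fun z => resolvent (toComplexMatrix M) z

theorem resolventFun_eq_inv {n : ℕ} (M : Matrix (Fin n) (Fin n) ℝ) (z : ℂ) :
    resolventFun M z = (z • (1 : Matrix (Fin n) (Fin n) ℂ) - toComplexMatrix M)⁻¹ := by
  rw [resolventFun, resolvent, Algebra.algebraMap_eq_smul_one, Matrix.nonsing_inv_eq_ringInverse]

/-- Index set of the upper triangle (diagonal included) of an `n × n` matrix. -/
abbrev UpperIdx (n : ℕ) : Type := {p : Fin n × Fin n // p.1 ≤ p.2}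

theorem card_upperIdx (n : ℕ) : Fintype.card (UpperIdx n) = n * (n + 1) / 2 := by
  have e : UpperIdx n ≃ Sym2 (Fin n) := (Sym2.sortEquiv (α := Fin n)).symm
  rw [Fintype.card_congr e, Sym2.card, Fintype.card_fin, Nat.choose_two_right,
    Nat.add_sub_cancel, mul_comm]

/-- Symmetric vectorization `svec`: diagonal entries are kept and the entries above the diagonal
are multiplied by `√2`. It is only used on symmetric matrices. -/
def svec {n : ℕ} : Matrix (Fin n) (Fin n) ℝ →ₗ[ℝ] (UpperIdx n → ℝ) where
  toFun M p := if p.1.1 = p.1.2 then M p.1.1 p.1.2 else √2 * M p.1.1 p.1.2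
  map_add' M M' := by
    ext p
    by_cases h : p.1.1 = p.1.2 <;> simp [h, mul_add]
  map_smul' a M := by
    ext p
    by_cases h : p.1.1 = p.1.2 <;> simp [h, mul_left_comm]

/-- `svec` preserves inner products of symmetric matrices. -/
theorem svec_dotProduct_svec {n : ℕ} {M M' : Matrix (Fin n) (Fin n) ℝ}
    (hM : M.IsSymm) (hM' : M'.IsSymm) : svec M ⬝ᵥ svec M' = (Mᵀ * M').trace := by
  have hR : (Mᵀ * M').trace = ∑ p : Fin n × Fin n, M p.1 p.2 * M' p.1 p.2 := by
    rw [Fintype.sum_prod_type_right]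
    rfl
  have hT : ∀ p : UpperIdx n, svec M p * svec M' p =
      M p.1.1 p.1.2 * M' p.1.1 p.1.2 +
        if p.1.1 < p.1.2 then M p.1.1 p.1.2 * M' p.1.1 p.1.2 else 0 := by
    rintro ⟨⟨i, j⟩, hij⟩
    by_cases h : i = j
    · simp [svec, h]
    · have hlt : i < j := lt_of_le_of_ne hij h
      have h2 : √2 * √2 = (2 : ℝ) := Real.mul_self_sqrt (by norm_num)
      simp only [svec, LinearMap.coe_mk, AddHom.coe_mk, h, if_false, hlt, if_true]
      linear_combination (M i j * M' i j) * h2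
  have hswap : ∑ p : Fin n × Fin n, (if p.2 < p.1 then M p.1 p.2 * M' p.1 p.2 else 0) =
      ∑ p : Fin n × Fin n, if p.1 < p.2 then M p.1 p.2 * M' p.1 p.2 else 0 := by
    rw [← (Equiv.prodComm (Fin n) (Fin n)).sum_comp]
    refine Finset.sum_congr rfl fun p _ => ?_
    simp only [Equiv.prodComm_apply, Prod.fst_swap, Prod.snd_swap]
    rw [hM.apply, hM'.apply]
    by_cases h : p.1 < p.2 <;> simp [h]
  have hsub : ∀ g : Fin n × Fin n → ℝ,
      ∑ p : UpperIdx n, g p.1 = ∑ p : Fin n × Fin n, if p.1 ≤ p.2 then g p else 0 := by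
    intro g
    rw [← Finset.sum_filter]
    exact (Finset.sum_subtype _ (by simp) g).symm
  rw [hR, dotProduct, Finset.sum_congr rfl fun p _ => hT p, Finset.sum_add_distrib,
    hsub (fun p => M p.1 p.2 * M' p.1 p.2),
    hsub (fun p => if p.1 < p.2 then M p.1 p.2 * M' p.1 p.2 else 0)]
  have hlt : ∑ p : Fin n × Fin n,
        (if p.1 ≤ p.2 then (if p.1 < p.2 then M p.1 p.2 * M' p.1 p.2 else 0) else 0) =
      ∑ p : Fin n × Fin n, if p.1 < p.2 then M p.1 p.2 * M' p.1 p.2 else 0 := by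
    refine Finset.sum_congr rfl fun p _ => ?_
    by_cases h : p.1 < p.2
    · simp [h, h.le]
    · simp [h]
  rw [hlt, ← hswap, ← Finset.sum_add_distrib]
  refine Finset.sum_congr rfl fun p _ => ?_
  by_cases h : p.1 ≤ p.2
  · simp [h, not_lt.mpr h]
  · simp [h, not_le.mp h]

/-- The feature map `φ(x) = svec(x xᵀ + η I)`. -/
def lqrFeature {n : ℕ} (η : ℝ) (x : EuclideanSpace ℝ (Fin n)) : UpperIdx n → ℝ :=
  svec (Matrix.vecMulVec x x + η • (1 : Matrix (Fin n) (Fin n) ℝ))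

/-- The state trajectory of `X_{k+1} = A X_k + B U_k + W_k` under the linear policy `U_k = K X_k`,
started at `X_0 = 0` and driven by the noise sequence `W`. -/
def lqrState {Ω : Type*} {n m : ℕ} (A : Matrix (Fin n) (Fin n) ℝ) (B : Matrix (Fin n) (Fin m) ℝ)
    (K : Matrix (Fin m) (Fin n) ℝ) (W : ℕ → Ω → EuclideanSpace ℝ (Fin n)) :
    ℕ → Ω → EuclideanSpace ℝ (Fin n)
  | 0, _ => 0
  | k + 1, ω =>
      WithLp.toLp 2 (A *ᵥ (lqrState A B K W k ω).ofLp
        + B *ᵥ (K *ᵥ (lqrState A B K W k ω).ofLp)) + W k ω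

/-- The unnormalized empirical second-moment matrix `∑_{k=1}^N φ(X_k) φ(X_k)ᵀ`. -/
def featureGram {Ω : Type*} {n : ℕ} (η : ℝ) (X : ℕ → Ω → EuclideanSpace ℝ (Fin n)) (N : ℕ)
    (ω : Ω) : Matrix (UpperIdx n) (UpperIdx n) ℝ :=
  ∑ k ∈ Finset.Icc 1 N, Matrix.vecMulVec (lqrFeature η (X k ω)) (lqrFeature η (X k ω))

/-- The mixing constant `Γ̃ = ‖Φ_{ρ⁻¹ L}‖_{H_∞} √(Tr P + n / (1 - ρ²))`. -/
def mixingConst {n : ℕ} (L P : Matrix (Fin n) (Fin n) ℝ) (ρ : ℝ) : ℝ :=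
  hinfNorm (resolventFun (ρ⁻¹ • L)) * √(P.trace + n / (1 - ρ ^ 2))

end

/-! ### Gaussian moments, and Gaussian vectors with covariance `I - A*A` -/

noncomputable section
open scoped RealInnerProductSpace

/-! Whitening. The Lyapunov equation forces `P ≥ I`, so `P = S Sᵀ` with `S` invertible, and `Y =
S⁻¹X` follows `Y_{k+1} = T Y_k + S⁻¹W_k` with `T = S⁻¹LS` and `T Tᵀ + S⁻¹S⁻ᵀ = I`. Hence `T` is a
contraction, and the noise accumulated over `j` steps is `N(0, I - T^j (T^j)ᵀ)`. For symmetric `M`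
the feature pairing is `⟨SᵀMS, YYᵀ + H⟩` with `H = η S⁻¹S⁻ᵀ`, and `‖SᵀMS‖_F ≥ λ_min(P) ‖M‖_F`. It
therefore suffices to bound `∑ ⟨u, Y_k Y_kᵀ + H⟩²` below by a multiple of `N` for all symmetric unit
`u` simultaneously (`le_lambdaMin_featureGram`).

One direction. Take `j` with `‖T^j‖ ≤ 1/2`. Given the past, the state `j` steps later is `b + ξ`,
where `ξ` has covariance at least `3/4 I`, and a quadratic polynomial of it is bounded away from
zero with probability at least `1/128`, whatever `b` is (`IsDefectGaussian.quadForm_smallBall`).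
Along times spaced by `j`, the exponential moment of minus the energy then decays geometrically
(`lintegral_chain_le`). A Lyapunov weight pays for truncating to `‖y‖² ≤ 384 n`. Jensen over
residues modulo `j` brings in all times.

All directions. Instead of a net, the exponential moment is integrated over a shell of directions,
and Markov's inequality gives one good event (`blockSum_lower_bound`). On it, Jensen on a ball of
radius `r` near any `u` recovers the energy at `u` (`le_blockSum_of_lintegral_lt`). The entropy cost
is `n² log(3/r)`. Averaging over a ball in dimension `n²` perturbs the energy by only `r²‖φ‖²/n²`,
so truncated features, of norm of order `n + ‖H‖`, allow `r` of order `1/(1 + ‖H‖/n)`.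

Block length. A resolvent bound gives `j(1-ρ) ≤ log(2Γ) + 1`, Cayley–Hamilton gives `j(1-ρ) ≤ 4n²`,
and a single `j` satisfies both (`exists_whiten_block_length`). With `κ = max(Tr(P)²,
η²n)/λ_min(P)²`, which dominates `n²` and `‖H‖²`, the hypothesis makes `N(1-ρ)` exceed a large
multiple of `κ log(ΓN/δ)`. Dividing by each bound on `j` in turn makes `N/j` large compared with `κ`
and with `log(ΓN/δ)`, which absorbs the entropy and confidence costs. -/

theorem integral_sq_gaussianReal (m : ℝ) (v : NNReal) :
    ∫ x, x ^ 2 ∂(gaussianReal m v) = m ^ 2 + v := by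
  have h := variance_eq_sub (μ := gaussianReal m v) (X := id) (memLp_id_gaussianReal 2)
  rw [variance_id_gaussianReal] at h
  simp at h
  linarith

/-- The moment is the fourth derivative at zero of the moment generating function; differentiation
keeps the form polynomial times `exp (u t)`, so `step` can be iterated. -/
theorem integral_pow_four_gaussianReal (m : ℝ) (v : NNReal) :
    ∫ x, x ^ 4 ∂(gaussianReal m v) = m ^ 4 + 6 * m ^ 2 * v + 3 * (v : ℝ) ^ 2 := by
  have h := iteratedDeriv_mgf_zero (X := id) (μ := gaussianReal m v)
    (by rw [integrableExpSet_id_gaussianReal]; simp) 4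
  simp only [Pi.pow_apply, id] at h
  rw [← h, mgf_id_gaussianReal]
  set u : ℝ → ℝ := fun t => m * t + v * t ^ 2 / 2 with hu
  have du : ∀ t, HasDerivAt u (m + v * t) t := fun t => by
    have := ((hasDerivAt_id t).const_mul m).add
      (((hasDerivAt_pow 2 t).const_mul (v : ℝ)).div_const 2)
    refine (this.congr_deriv ?_)
    simp; ring
  have step : ∀ (p p' : ℝ → ℝ), (∀ t, HasDerivAt p (p' t) t) →
      deriv (fun t => p t * Real.exp (u t)) =
        fun t => (p' t + p t * (m + v * t)) * Real.exp (u t) := by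
    intro p p' hp
    ext t
    refine (((hp t).mul ((du t).exp)).congr_deriv ?_).deriv
    ring
  have dl : ∀ t, HasDerivAt (fun t => m + (v : ℝ) * t) v t := fun t => by
    simpa using ((hasDerivAt_id t).const_mul (v : ℝ)).const_add m
  have e0 : (fun t => Real.exp (u t)) = fun t => (1 : ℝ) * Real.exp (u t) := by simp
  rw [iteratedDeriv_eq_iterate]
  simp only [Function.iterate_succ, Function.iterate_zero, Function.comp, id]
  rw [e0, step (fun _ => 1) (fun _ => 0) (fun t => hasDerivAt_const t _)]
  rw [step (fun t => 0 + 1 * (m + v * t)) (fun _ => v) (fun t => by simpa using dl t)]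
  rw [step (fun t => v + (0 + 1 * (m + v * t)) * (m + v * t)) (fun t => 2 * v * (m + v * t))
    (fun t => by
      have := ((dl t).mul (dl t)).const_add (v : ℝ)
      refine (this.congr_deriv (by ring)).congr_of_eventuallyEq ?_
      exact Filter.Eventually.of_forall fun s => by simp)]
  rw [step _ (fun t => 2 * v * v + ((v * (m + v * t) + (m + v * t) * v) * (m + v * t)
      + (v + (m + v * t) * (m + v * t)) * v))
    (fun t => by
      have h2 := ((dl t).mul (dl t)).const_add (v : ℝ)
      have h3 := ((dl t).const_mul (2 * (v : ℝ))).add (h2.mul (dl t))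
      refine (h3.congr_deriv ?_).congr_of_eventuallyEq ?_
      · simp
      · exact Filter.Eventually.of_forall fun s => by simp)]
  simp [hu]
  ring

/-- Paley–Zygmund inequality at level one half. -/
theorem paleyZygmund_half {Ω : Type*} [MeasurableSpace Ω] {μ : Measure Ω} [IsProbabilityMeasure μ]
    {D : Ω → ℝ} (hDm : Measurable D) (hD : Integrable D μ)
    (hD2 : Integrable (fun ω => D ω ^ 2) μ) {K : ℝ} (hK : 0 < K) (hm : 0 < ∫ ω, D ω ∂μ)
    (hKm : ∫ ω, D ω ^ 2 ∂μ ≤ K * (∫ ω, D ω ∂μ) ^ 2) :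
    1 / (4 * K) ≤ μ.real {ω | (∫ ω, D ω ∂μ) / 2 ≤ D ω} := by
  set m := ∫ ω, D ω ∂μ with hmdef
  set A := {ω | m / 2 ≤ D ω}
  have hA : MeasurableSet A := measurableSet_le measurable_const hDm
  -- On `A` this is `D ≤ D²/(4Km) + Km`, a completed square; off `A`, `D < m/2`. Integrating gives
  -- `m ≤ m/2 + m/4 + K m μ(A)`.
  have hpt : ∀ ω, D ω ≤ m / 2 + (1 / (4 * K * m)) * D ω ^ 2 + A.indicator (fun _ => K * m) ω := by
    intro ω
    by_cases h : ω ∈ A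
    · rw [Set.indicator_of_mem h]
      have : (1 / (4 * K * m)) * D ω ^ 2 + K * m - D ω =
          (1 / (4 * K * m)) * (D ω - 2 * K * m) ^ 2 := by
        field_simp; ring
      have h2 : 0 ≤ (1 / (4 * K * m)) * (D ω - 2 * K * m) ^ 2 := by positivity
      linarith
    · rw [Set.indicator_of_notMem h]
      have h1 : D ω < m / 2 := not_le.mp h
      have h2 : 0 ≤ (1 / (4 * K * m)) * D ω ^ 2 := by positivity
      linarith
  have hint : Integrable (fun ω => A.indicator (fun _ => K * m) ω) μ :=
    (integrable_const _).indicator hA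
  have hint2 : Integrable (fun ω => m / 2 + 1 / (4 * K * m) * D ω ^ 2) μ :=
    (integrable_const _).add (hD2.const_mul _)
  have h := integral_mono hD (hint2.add hint) hpt
  simp only [Pi.add_apply] at h
  rw [integral_add hint2 hint,
    integral_add (integrable_const _) (hD2.const_mul _), integral_const_mul,
    integral_indicator hA, setIntegral_const] at h
  simp only [integral_const, probReal_univ, smul_eq_mul, one_mul] at h
  have h3 : 1 / (4 * K * m) * ∫ ω, D ω ^ 2 ∂μ ≤ m / 4 := by
    calc _ ≤ 1 / (4 * K * m) * (K * m ^ 2) := by gcongr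
      _ = m / 4 := by field_simp
  rw [← hmdef] at h
  rw [div_le_iff₀ (by positivity)]
  have : m * 1 ≤ m * (μ.real A * (4 * K)) := by nlinarith
  exact le_of_mul_le_mul_left this hm

/-- The quadratic form `t ↦ ‖t‖² - ‖A t‖²`. -/
def defectForm {E : Type*} [NormedAddCommGroup E] [InnerProductSpace ℝ E] (A : E →L[ℝ] E)
    (t : E) : ℝ := ‖t‖ ^ 2 - ‖A t‖ ^ 2

theorem defectForm_smul {E : Type*} [NormedAddCommGroup E] [InnerProductSpace ℝ E]
    (A : E →L[ℝ] E) (c : ℝ) (t : E) : defectForm A (c • t) = c ^ 2 * defectForm A t := by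
  simp only [defectForm, map_smul, norm_smul, Real.norm_eq_abs, mul_pow, sq_abs]
  ring

theorem defectForm_le {E : Type*} [NormedAddCommGroup E] [InnerProductSpace ℝ E]
    (A : E →L[ℝ] E) (t : E) : defectForm A t ≤ ‖t‖ ^ 2 := by
  have := sq_nonneg ‖A t‖
  simp only [defectForm]; linarith

theorem le_defectForm {E : Type*} [NormedAddCommGroup E] [InnerProductSpace ℝ E]
    {A : E →L[ℝ] E} (hA : ‖A‖ ≤ 1 / 2) (t : E) : 3 / 4 * ‖t‖ ^ 2 ≤ defectForm A t := by
  have h1 : ‖A t‖ ≤ 1 / 2 * ‖t‖ := (A.le_opNorm t).trans (by gcongr)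
  have h2 : ‖A t‖ ^ 2 ≤ (1 / 2 * ‖t‖) ^ 2 := by gcongr
  simp only [defectForm]; nlinarith

theorem defectForm_nonneg {E : Type*} [NormedAddCommGroup E] [InnerProductSpace ℝ E]
    {A : E →L[ℝ] E} (hA : ‖A‖ ≤ 1) (t : E) : 0 ≤ defectForm A t := by
  have h1 : ‖A t‖ ≤ 1 * ‖t‖ := (A.le_opNorm t).trans (by gcongr)
  have h2 : ‖A t‖ ^ 2 ≤ (1 * ‖t‖) ^ 2 := by gcongr
  simp only [defectForm]; nlinarith

/-- `ν` is the centered Gaussian measure with covariance form `t ↦ ‖t‖² - ‖A t‖²`. -/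
def IsDefectGaussian {E : Type*} [NormedAddCommGroup E] [InnerProductSpace ℝ E]
    [MeasurableSpace E] (A : E →L[ℝ] E) (ν : Measure E) : Prop :=
  ∀ t, charFun ν t = Complex.exp (((-(defectForm A t) / 2 : ℝ)) : ℂ)

section Gaussian

variable {E : Type*} [NormedAddCommGroup E] [InnerProductSpace ℝ E] [FiniteDimensional ℝ E]
  [MeasurableSpace E] [BorelSpace E] {A : E →L[ℝ] E} {ν : Measure E} [IsProbabilityMeasure ν]

theorem IsDefectGaussian.map_inner (hν : IsDefectGaussian A ν) (hA : ‖A‖ ≤ 1) (m : ℝ) (h : E) :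
    ν.map (fun x => m + ⟪x, h⟫) = gaussianReal m (defectForm A h).toNNReal := by
  have hmeas : Measurable fun x : E => ⟪x, h⟫ := by fun_prop
  have h0 : ν.map (fun x => ⟪x, h⟫) = gaussianReal 0 (defectForm A h).toNNReal := by
    have : IsProbabilityMeasure (ν.map (fun x => ⟪x, h⟫)) :=
      Measure.isProbabilityMeasure_map hmeas.aemeasurable
    apply Measure.ext_of_charFun
    ext s
    rw [charFun_gaussianReal, charFun_apply, integral_map hmeas.aemeasurable (by fun_prop)]
    have := hν (s • h)
    rw [charFun_apply] at this
    simp only [inner_smul_right] at this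
    simp only [RCLike.inner_apply, conj_trivial]
    rw [this, defectForm_smul, Real.coe_toNNReal _ (defectForm_nonneg hA h)]
    push_cast
    ring_nf
  have := gaussianReal_map_const_add (μ := 0) (v := (defectForm A h).toNNReal) m
  rw [← h0, Measure.map_map (by fun_prop) hmeas] at this
  simpa [Function.comp_def] using this

theorem IsDefectGaussian.integrable_pow (hν : IsDefectGaussian A ν) (hA : ‖A‖ ≤ 1) (m : ℝ) (h : E)
    (k : ℕ) : Integrable (fun x => (m + ⟪x, h⟫) ^ k) ν := by
  have h1 : Integrable (fun x : ℝ => x ^ k) (gaussianReal m (defectForm A h).toNNReal) := by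
    have := (memLp_id_gaussianReal (μ := m) (v := (defectForm A h).toNNReal) k).integrable_norm_pow'
    refine (integrable_norm_iff (by fun_prop)).mp ?_
    simpa using this
  rw [← hν.map_inner hA m h] at h1
  exact h1.comp_measurable (by fun_prop)

theorem IsDefectGaussian.integral_sq (hν : IsDefectGaussian A ν) (hA : ‖A‖ ≤ 1) (m : ℝ) (h : E) :
    ∫ x, (m + ⟪x, h⟫) ^ 2 ∂ν = m ^ 2 + defectForm A h := by
  have := integral_sq_gaussianReal m (defectForm A h).toNNReal
  rw [← hν.map_inner hA m h, integral_map (by fun_prop) (by fun_prop),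
    Real.coe_toNNReal _ (defectForm_nonneg hA h)] at this
  exact this

theorem IsDefectGaussian.integral_pow_four (hν : IsDefectGaussian A ν) (hA : ‖A‖ ≤ 1) (m : ℝ)
    (h : E) : ∫ x, (m + ⟪x, h⟫) ^ 4 ∂ν =
      m ^ 4 + 6 * m ^ 2 * defectForm A h + 3 * defectForm A h ^ 2 := by
  have := integral_pow_four_gaussianReal m (defectForm A h).toNNReal
  rw [← hν.map_inner hA m h, integral_map (by fun_prop) (by fun_prop),
    Real.coe_toNNReal _ (defectForm_nonneg hA h)] at this
  exact this

/-- The exponent of the characteristic function is quadratic, so the two factors contribute weights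
`c²` and `d²`. This splits one Gaussian vector into two independent ones, as decoupling requires. -/
theorem IsDefectGaussian.map_rotation (hν : IsDefectGaussian A ν) {c d : ℝ}
    (hcd : c ^ 2 + d ^ 2 = 1) :
    (ν.prod ν).map (fun p : E × E => c • p.1 + d • p.2) = ν := by
  have hmeas : Measurable fun p : E × E => c • p.1 + d • p.2 := by fun_prop
  have : IsProbabilityMeasure ((ν.prod ν).map (fun p : E × E => c • p.1 + d • p.2)) :=
    Measure.isProbabilityMeasure_map hmeas.aemeasurable
  apply Measure.ext_of_charFun
  ext t
  rw [charFun_apply, integral_map hmeas.aemeasurable (by fun_prop), hν t]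
  have e : ∀ p : E × E, Complex.exp (⟪c • p.1 + d • p.2, t⟫ * Complex.I) =
      Complex.exp (⟪p.1, c • t⟫ * Complex.I) * Complex.exp (⟪p.2, d • t⟫ * Complex.I) := by
    intro p
    rw [← Complex.exp_add]
    congr 1
    simp only [inner_add_left, inner_smul_left, inner_smul_right, conj_trivial]
    push_cast
    ring
  simp_rw [e]
  rw [integral_prod_mul (f := fun x : E => Complex.exp (⟪x, c • t⟫ * Complex.I))
    (g := fun x : E => Complex.exp (⟪x, d • t⟫ * Complex.I)), ← charFun_apply, ← charFun_apply,
    hν, hν, ← Complex.exp_add, defectForm_smul, defectForm_smul, ← Complex.ofReal_add]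
  congr 2
  linear_combination (-(defectForm A t) / 2) * hcd

variable {ι : Type*} [Fintype ι]

theorem integral_mul_le_of_sq_le {Ω : Type*} [MeasurableSpace Ω] {μ : Measure Ω}
    {f g : Ω → ℝ} (hf : 0 ≤ f) (hg : 0 ≤ g) (hfm : AEStronglyMeasurable f μ)
    (hgm : AEStronglyMeasurable g μ)
    (hf2 : Integrable (fun ω => f ω ^ 2) μ) (hg2 : Integrable (fun ω => g ω ^ 2) μ)
    {a b : ℝ} (ha : 0 ≤ a) (hb : 0 ≤ b) (hfa : ∫ ω, f ω ^ 2 ∂μ ≤ a ^ 2)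
    (hgb : ∫ ω, g ω ^ 2 ∂μ ≤ b ^ 2) : ∫ ω, f ω * g ω ∂μ ≤ a * b := by
  have h := integral_mul_le_Lp_mul_Lq_of_nonneg (μ := μ) (f := f) (g := g) (p := 2) (q := 2)
    (by constructor <;> norm_num) (.of_forall hf) (.of_forall hg)
    (by simpa using (memLp_two_iff_integrable_sq hfm).mpr hf2)
    (by simpa using (memLp_two_iff_integrable_sq hgm).mpr hg2)
  refine h.trans ?_
  simp only [Real.rpow_ofNat, ← Real.sqrt_eq_rpow]
  gcongr
  · exact Real.sqrt_le_iff.mpr ⟨ha, hfa⟩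
  · exact Real.sqrt_le_iff.mpr ⟨hb, hgb⟩

theorem IsDefectGaussian.integrable_sum_sq (hν : IsDefectGaussian A ν) (hA : ‖A‖ ≤ 1) (b : ι → ℝ)
    (w : ι → E) : Integrable (fun x => ∑ i, (b i + ⟪x, w i⟫) ^ 2) ν :=
  integrable_finsetSum _ fun i _ => hν.integrable_pow hA (b i) (w i) 2

theorem IsDefectGaussian.integral_sum_sq (hν : IsDefectGaussian A ν) (hA : ‖A‖ ≤ 1) (b : ι → ℝ)
    (w : ι → E) : ∫ x, ∑ i, (b i + ⟪x, w i⟫) ^ 2 ∂ν = ∑ i, (b i ^ 2 + defectForm A (w i)) := by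
  rw [integral_finsetSum _ fun i _ => hν.integrable_pow hA (b i) (w i) 2]
  simp_rw [hν.integral_sq hA]

theorem IsDefectGaussian.integrable_mul_sq (hν : IsDefectGaussian A ν) (hA : ‖A‖ ≤ 1) (m m' : ℝ)
    (h h' : E) : Integrable (fun x => (m + ⟪x, h⟫) ^ 2 * (m' + ⟪x, h'⟫) ^ 2) ν := by
  refine ((hν.integrable_pow hA m h 4).add (hν.integrable_pow hA m' h' 4)).mono' (by fun_prop)
    (.of_forall fun x => ?_)
  rw [Real.norm_of_nonneg (by positivity)]
  simp only [Pi.add_apply]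
  nlinarith [sq_nonneg ((m + ⟪x, h⟫) ^ 2 - (m' + ⟪x, h'⟫) ^ 2),
    sq_nonneg ((m + ⟪x, h⟫) ^ 2), sq_nonneg ((m' + ⟪x, h'⟫) ^ 2)]

theorem IsDefectGaussian.integrable_sum_sq_sq (hν : IsDefectGaussian A ν) (hA : ‖A‖ ≤ 1)
    (b : ι → ℝ) (w : ι → E) : Integrable (fun x => (∑ i, (b i + ⟪x, w i⟫) ^ 2) ^ 2) ν := by
  simp_rw [sq (∑ i, _), Finset.sum_mul_sum]
  exact integrable_finsetSum _ fun i _ => integrable_finsetSum _ fun j _ =>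
    hν.integrable_mul_sq hA _ _ _ _

/-- A scalar Gaussian with mean `b` and variance `q` has fourth moment `b⁴ + 6b²q + 3q² ≤ 3(b² +
q)²`. Cauchy–Schwarz on the cross terms keeps the constant `3` independent of the dimension. -/
theorem IsDefectGaussian.integral_sum_sq_sq_le (hν : IsDefectGaussian A ν) (hA : ‖A‖ ≤ 1)
    (b : ι → ℝ) (w : ι → E) : ∫ x, (∑ i, (b i + ⟪x, w i⟫) ^ 2) ^ 2 ∂ν ≤
      3 * (∑ i, (b i ^ 2 + defectForm A (w i))) ^ 2 := by
  simp_rw [sq (∑ i, _), Finset.sum_mul_sum]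
  rw [integral_finsetSum _ fun i _ => integrable_finsetSum _ fun j _ =>
    hν.integrable_mul_sq hA _ _ _ _, Finset.mul_sum]
  refine Finset.sum_le_sum fun i _ => ?_
  rw [integral_finsetSum _ fun j _ => hν.integrable_mul_sq hA _ _ _ _, Finset.mul_sum]
  refine Finset.sum_le_sum fun j _ => ?_
  have hq := fun i => defectForm_nonneg hA (w i)
  have key : ∀ i, ∫ x, ((b i + ⟪x, w i⟫) ^ 2) ^ 2 ∂ν ≤
      (√3 * (b i ^ 2 + defectForm A (w i))) ^ 2 := by
    intro i
    simp_rw [← pow_mul]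
    rw [hν.integral_pow_four hA, mul_pow, Real.sq_sqrt (by norm_num)]
    nlinarith [sq_nonneg (b i), hq i, sq_nonneg (b i ^ 2)]
  have hint : ∀ i, Integrable (fun x => ((b i + ⟪x, w i⟫) ^ 2) ^ 2) ν := fun i => by
    simp_rw [← pow_mul]; exact hν.integrable_pow hA _ _ _
  have hnn : ∀ i, 0 ≤ √3 * (b i ^ 2 + defectForm A (w i)) := fun i => by
    have := hq i; positivity
  refine (integral_mul_le_of_sq_le (fun x => sq_nonneg _) (fun x => sq_nonneg _)
    (hν.integrable_pow hA _ _ 2).aestronglyMeasurable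
    (hν.integrable_pow hA _ _ 2).aestronglyMeasurable (hint i) (hint j) (hnn i) (hnn j) (key i)
    (key j)).trans (le_of_eq ?_)
  linear_combination (b i ^ 2 + defectForm A (w i)) * (b j ^ 2 + defectForm A (w j)) *
    (Real.mul_self_sqrt (show (0 : ℝ) ≤ 3 by norm_num))

end Gaussian
end

/-! ### Small-ball estimate for quadratic polynomials of a Gaussian vector -/

noncomputable section
open scoped RealInnerProductSpace

section SmallBall

variable {ι : Type*} [Fintype ι]

/-- The quadratic form `y ↦ ∑ M a b y a y b`. -/
def quadForm (M : ι → ι → ℝ) (y : EuclideanSpace ℝ ι) : ℝ := ∑ a, ∑ b, M a b * (y a * y b)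

/-- The matrix-vector product, as a vector of the Euclidean space. -/
def quadGrad (M : ι → ι → ℝ) (y : EuclideanSpace ℝ ι) : EuclideanSpace ℝ ι :=
  WithLp.toLp 2 fun a => ∑ b, M a b * y b

theorem continuous_quadForm (M : ι → ι → ℝ) : Continuous (quadForm M) := by
  unfold quadForm; fun_prop

theorem continuous_quadGrad (M : ι → ι → ℝ) : Continuous (quadGrad M) := by
  unfold quadGrad; fun_prop

/-- Polarization: with `y` frozen the difference is linear in `z`, and any additive constant in the
polynomial cancels. -/
theorem quadForm_add_sub (M : ι → ι → ℝ) (hM : ∀ a b, M a b = M b a)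
    (y z : EuclideanSpace ℝ ι) :
    quadForm M (y + z) - quadForm M (y - z) = 4 * ⟪z, quadGrad M y⟫ := by
  have h1 : ⟪z, quadGrad M y⟫ = ∑ a, ∑ b, M a b * (z a * y b) := by
    simp only [quadGrad, PiLp.inner_apply, RCLike.inner_apply, conj_trivial, Finset.sum_mul]
    exact Finset.sum_congr rfl fun a _ => Finset.sum_congr rfl fun b _ => by ring
  have h2 : ∑ a, ∑ b, M a b * (y a * z b) = ∑ a, ∑ b, M a b * (z a * y b) := by
    rw [Finset.sum_comm]
    refine Finset.sum_congr rfl fun a _ => Finset.sum_congr rfl fun b _ => ?_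
    rw [hM b a]; ring
  have h3 : quadForm M (y + z) - quadForm M (y - z) =
      2 * ∑ a, ∑ b, M a b * (y a * z b) + 2 * ∑ a, ∑ b, M a b * (z a * y b) := by
    simp only [quadForm, Finset.mul_sum, ← Finset.sum_add_distrib, ← Finset.sum_sub_distrib,
      PiLp.add_apply, PiLp.sub_apply]
    exact Finset.sum_congr rfl fun a _ => Finset.sum_congr rfl fun b _ => by ring
  rw [h3, h2, h1]; ring

variable {A : EuclideanSpace ℝ ι →L[ℝ] EuclideanSpace ℝ ι} {ν : Measure (EuclideanSpace ℝ ι)}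
  [IsProbabilityMeasure ν]

theorem IsDefectGaussian.integrable_norm_sq (hν : IsDefectGaussian A ν) (hA : ‖A‖ ≤ 1) :
    Integrable (fun x => ‖x‖ ^ 2) ν := by
  classical
  have := hν.integrable_sum_sq hA (fun _ => 0) fun i => EuclideanSpace.single i (1 : ℝ)
  simpa [EuclideanSpace.inner_single_right, EuclideanSpace.real_norm_sq_eq] using this

theorem IsDefectGaussian.integrable_norm_sq_sq (hν : IsDefectGaussian A ν) (hA : ‖A‖ ≤ 1) :
    Integrable (fun x => (‖x‖ ^ 2) ^ 2) ν := by
  classical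
  have := hν.integrable_sum_sq_sq hA (fun _ => 0) fun i => EuclideanSpace.single i (1 : ℝ)
  simpa [EuclideanSpace.inner_single_right, EuclideanSpace.real_norm_sq_eq] using this

/-- The second moment of `b + ξ` for a Gaussian vector `ξ` with covariance at most the identity. -/
theorem IsDefectGaussian.integral_norm_add_sq_le (hν : IsDefectGaussian A ν) (hA : ‖A‖ ≤ 1)
    (b : EuclideanSpace ℝ ι) :
    Integrable (fun x => ‖b + x‖ ^ 2) ν ∧ ∫ x, ‖b + x‖ ^ 2 ∂ν ≤ ‖b‖ ^ 2 + Fintype.card ι := by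
  classical
  have h1 := hν.integrable_sum_sq hA b fun i => EuclideanSpace.single i (1 : ℝ)
  have h2 := hν.integral_sum_sq hA b fun i => EuclideanSpace.single i (1 : ℝ)
  have e : ∀ x : EuclideanSpace ℝ ι,
      ∑ i, (b i + ⟪x, EuclideanSpace.single i (1 : ℝ)⟫) ^ 2 = ‖b + x‖ ^ 2 := by
    intro x
    simp [EuclideanSpace.inner_single_right, EuclideanSpace.real_norm_sq_eq]
  simp_rw [e] at h1 h2
  refine ⟨h1, ?_⟩
  rw [h2, Finset.sum_add_distrib, ← EuclideanSpace.real_norm_sq_eq]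
  gcongr
  calc ∑ i, defectForm A (EuclideanSpace.single i (1 : ℝ))
      ≤ ∑ _i : ι, (1 : ℝ) := Finset.sum_le_sum fun i _ => by
        simpa using defectForm_le A (EuclideanSpace.single i (1 : ℝ))
    _ = Fintype.card ι := by simp

/-- Given the first vector, the pairing is a centered Gaussian with variance between `3/4 ‖g‖²` and
`‖g‖²`. With `m = E‖g‖²`, its square has mean at least `3m/4` and second moment at most `3 · 3m² =
16 (3m/4)²`, so Paley–Zygmund applies with `K = 16`. Since `m ≥ 3/8`, half the mean is at least
`9/64`. -/
theorem IsDefectGaussian.inner_quadGrad_smallBall (hν : IsDefectGaussian A ν) (hA : ‖A‖ ≤ 1 / 2)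
    (M : ι → ι → ℝ) (hM1 : 1 ≤ ∑ a, ∑ b, M a b ^ 2) (a : EuclideanSpace ℝ ι) {r : ℝ}
    (hr : r ^ 2 = 1 / 2) :
    1 / 64 ≤ (ν.prod ν).real {p | 9 / 64 ≤ ⟪p.2, quadGrad M (a + r • p.1)⟫ ^ 2} := by
  have hA1 : ‖A‖ ≤ 1 := hA.trans (by norm_num)
  set g : EuclideanSpace ℝ ι → EuclideanSpace ℝ ι := fun x => quadGrad M (a + r • x) with hg
  have hgc : Continuous g := (continuous_quadGrad M).comp (by fun_prop)
  set b : ι → ℝ := fun i => ∑ j, M i j * a j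
  set w : ι → EuclideanSpace ℝ ι := fun i => r • WithLp.toLp 2 (M i)
  have hgS : ∀ x, ‖g x‖ ^ 2 = ∑ i, (b i + ⟪x, w i⟫) ^ 2 := by
    intro x
    rw [EuclideanSpace.real_norm_sq_eq]
    refine Finset.sum_congr rfl fun i _ => ?_
    congr 1
    simp only [hg, quadGrad, b, w, inner_smul_right, PiLp.inner_apply, RCLike.inner_apply,
      conj_trivial, Finset.mul_sum, ← Finset.sum_add_distrib, PiLp.add_apply, PiLp.smul_apply,
      smul_eq_mul]
    exact Finset.sum_congr rfl fun j _ => by ring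
  set m := ∑ i, (b i ^ 2 + defectForm A (w i))
  have hS1 : Integrable (fun x => ‖g x‖ ^ 2) ν := by
    simp_rw [hgS]; exact hν.integrable_sum_sq hA1 b w
  have hS2 : Integrable (fun x => (‖g x‖ ^ 2) ^ 2) ν := by
    simp_rw [hgS]; exact hν.integrable_sum_sq_sq hA1 b w
  have hSm : ∫ x, ‖g x‖ ^ 2 ∂ν = m := by simp_rw [hgS]; exact hν.integral_sum_sq hA1 b w
  have hSm2 : ∫ x, (‖g x‖ ^ 2) ^ 2 ∂ν ≤ 3 * m ^ 2 := by
    simp_rw [hgS]; exact hν.integral_sum_sq_sq_le hA1 b w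
  have hm : 3 / 8 ≤ m := by
    calc (3 / 8 : ℝ) ≤ 3 / 8 * ∑ i, ∑ j, M i j ^ 2 := by linarith
      _ ≤ m := by
        rw [Finset.mul_sum]
        refine Finset.sum_le_sum fun i _ => ?_
        have h1 : 3 / 4 * ‖w i‖ ^ 2 ≤ defectForm A (w i) := le_defectForm hA _
        have h2 : ‖w i‖ ^ 2 = 1 / 2 * ∑ j, M i j ^ 2 := by
          simp only [w]
          rw [norm_smul, mul_pow, Real.norm_eq_abs, sq_abs, hr, EuclideanSpace.real_norm_sq_eq]
        have := sq_nonneg (b i)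
        linarith
  set D : EuclideanSpace ℝ ι × EuclideanSpace ℝ ι → ℝ := fun p => ⟪p.2, g p.1⟫ ^ 2 with hD
  have hDc : Continuous D := by fun_prop
  have hbound : ∀ p, D p ≤ ‖g p.1‖ ^ 2 * ‖p.2‖ ^ 2 := by
    intro p
    have := abs_real_inner_le_norm p.2 (g p.1)
    calc D p = |⟪p.2, g p.1⟫| ^ 2 := (sq_abs _).symm
      _ ≤ (‖p.2‖ * ‖g p.1‖) ^ 2 := by gcongr
      _ = _ := by ring
  have hD1 : Integrable D (ν.prod ν) := by
    refine (hS1.mul_prod (hν.integrable_norm_sq hA1)).mono' hDc.aestronglyMeasurable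
      (.of_forall fun p => ?_)
    rw [Real.norm_of_nonneg (sq_nonneg _)]
    exact hbound p
  have hD2 : Integrable (fun p => D p ^ 2) (ν.prod ν) := by
    refine (hS2.mul_prod (hν.integrable_norm_sq_sq hA1)).mono'
      (by exact (hDc.pow 2).aestronglyMeasurable) (.of_forall fun p => ?_)
    rw [Real.norm_of_nonneg (sq_nonneg _), ← mul_pow]
    have : 0 ≤ D p := sq_nonneg _
    gcongr
    exact hbound p
  have hDint : 3 / 4 * m ≤ ∫ p, D p ∂(ν.prod ν) := by
    rw [integral_prod _ hD1, ← hSm, ← integral_const_mul]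
    refine integral_mono (hS1.const_mul _) hD1.integral_prod_left fun x => ?_
    have := hν.integral_sq hA1 0 (g x)
    simp only [zero_add, hD] at this ⊢
    rw [this]
    have := le_defectForm hA (g x)
    linarith
  have hD2int : ∫ p, D p ^ 2 ∂(ν.prod ν) ≤ 9 * m ^ 2 := by
    rw [integral_prod _ hD2]
    calc _ ≤ ∫ x, 3 * (‖g x‖ ^ 2) ^ 2 ∂ν := by
          refine integral_mono hD2.integral_prod_left (hS2.const_mul _) fun x => ?_
          have := hν.integral_pow_four hA1 0 (g x)
          simp only [zero_add] at this
          simp only [hD, ← pow_mul]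
          rw [show 2 * 2 = 4 from rfl, this]
          have h1 := defectForm_le A (g x)
          have h2 := defectForm_nonneg hA1 (g x)
          have : defectForm A (g x) ^ 2 ≤ (‖g x‖ ^ 2) ^ 2 := by gcongr
          rw [← pow_mul] at this
          norm_num at this ⊢
          linarith
      _ ≤ 9 * m ^ 2 := by rw [integral_const_mul]; linarith
  have hpz := paleyZygmund_half (μ := ν.prod ν) (D := D) hDc.measurable hD1 hD2 (K := 16)
    (by norm_num) (by linarith) (by nlinarith)
  refine (by norm_num : (1 / 64 : ℝ) ≤ 1 / (4 * 16)).trans (hpz.trans ?_)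
  refine measureReal_mono fun p hp => ?_
  have hp' : (∫ p, D p ∂(ν.prod ν)) / 2 ≤ D p := hp
  change 9 / 64 ≤ D p
  linarith

/-- Small-ball estimate for an inhomogeneous quadratic polynomial of a Gaussian vector. -/
theorem IsDefectGaussian.quadForm_smallBall (hν : IsDefectGaussian A ν) (hA : ‖A‖ ≤ 1 / 2)
    (M : ι → ι → ℝ) (hM : ∀ a b, M a b = M b a) (hM1 : 1 ≤ ∑ a, ∑ b, M a b ^ 2)
    (a : EuclideanSpace ℝ ι) (c : ℝ) :
    1 / 128 ≤ ν.real {x | 1 / 4 ≤ (quadForm M (a + x) + c) ^ 2} := by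
  obtain ⟨r, hr⟩ : ∃ r : ℝ, r ^ 2 = 1 / 2 := ⟨√(1 / 2), Real.sq_sqrt (by norm_num)⟩
  set G : Set (EuclideanSpace ℝ ι) := {x | 1 / 4 ≤ (quadForm M (a + x) + c) ^ 2}
  have hG : MeasurableSet G := measurableSet_le measurable_const
    (((((continuous_quadForm M).comp (continuous_const.add continuous_id)).add
      continuous_const).pow 2).measurable)
  have h1 := hν.inner_quadGrad_smallBall hA M hM1 a hr
  have e1 : ν.real G = (ν.prod ν).real {p | r • p.1 + r • p.2 ∈ G} := by
    conv_lhs => rw [← hν.map_rotation (c := r) (d := r) (by rw [hr]; norm_num)]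
    rw [map_measureReal_apply (by fun_prop) hG]; rfl
  have e2 : ν.real G = (ν.prod ν).real {p | r • p.1 + (-r) • p.2 ∈ G} := by
    conv_lhs => rw [← hν.map_rotation (c := r) (d := -r) (by rw [neg_sq, hr]; norm_num)]
    rw [map_measureReal_apply (by fun_prop) hG]; rfl
  -- Both `r(p₁ + p₂)` and `r(p₁ - p₂)` have law `ν`. If the polynomial values `u`, `v` at both were
  -- below `1/2` in modulus, then `(u - v)² ≤ 2(u² + v²) < 1`, against `(u - v)² = 8t² ≥ 9/8`. So
  -- one of the two copies is large, and the probability halves.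
  have hsub : {p : EuclideanSpace ℝ ι × EuclideanSpace ℝ ι |
      9 / 64 ≤ ⟪p.2, quadGrad M (a + r • p.1)⟫ ^ 2} ⊆
      {p | r • p.1 + r • p.2 ∈ G} ∪ {p | r • p.1 + (-r) • p.2 ∈ G} := by
    intro p hp
    by_contra hcon
    simp only [Set.mem_union, Set.mem_ofPred_eq, not_or, G, not_le] at hcon hp
    have hq := quadForm_add_sub M hM (a + r • p.1) (r • p.2)
    rw [add_assoc, show a + r • p.1 - r • p.2 = a + (r • p.1 + (-r) • p.2) by
      rw [neg_smul]; abel, inner_smul_left, conj_trivial] at hq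
    set u := quadForm M (a + (r • p.1 + r • p.2)) + c
    set v := quadForm M (a + (r • p.1 + (-r) • p.2)) + c
    set t := ⟪p.2, quadGrad M (a + r • p.1)⟫
    have huv : u - v = 4 * (r * t) := by rw [← hq]; ring
    have : (u - v) ^ 2 = 8 * t ^ 2 := by rw [huv]; linear_combination 16 * t ^ 2 * hr
    nlinarith [sq_nonneg (u + v)]
  have h2 := (measureReal_mono (μ := ν.prod ν) hsub).trans (measureReal_union_le _ _)
  rw [← e1, ← e2] at h2
  linarith

end SmallBall
end

/-! ### One-step contraction with a Lyapunov weight -/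

noncomputable section
open scoped RealInnerProductSpace

section OneStep

variable {ι : Type*} [Fintype ι]

/-- The Lyapunov function `y ↦ 1 + ‖y‖² / (2048 n)` that controls excursions of the chain. -/
def lyapunovWeight (y : EuclideanSpace ℝ ι) : ℝ := 1 + 1 / 2048 * (‖y‖ ^ 2 / Fintype.card ι)

/-- The square of `g`, truncated to the ball of radius `√(384 n)`. -/
def truncSq (g : EuclideanSpace ℝ ι → ℝ) (y : EuclideanSpace ℝ ι) : ℝ :=
  if ‖y‖ ^ 2 ≤ 384 * Fintype.card ι then g y ^ 2 else 0

theorem truncSq_nonneg (g : EuclideanSpace ℝ ι → ℝ) (y : EuclideanSpace ℝ ι) :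
    0 ≤ truncSq g y := by
  unfold truncSq; split_ifs <;> positivity

theorem measurable_truncSq {g : EuclideanSpace ℝ ι → ℝ} (hg : Measurable g) :
    Measurable (truncSq g) :=
  Measurable.ite (measurableSet_le (by fun_prop) measurable_const) (hg.pow_const 2)
    measurable_const

theorem one_le_lyapunovWeight (y : EuclideanSpace ℝ ι) : 1 ≤ lyapunovWeight y := by
  have : 0 ≤ 1 / 2048 * (‖y‖ ^ 2 / (Fintype.card ι : ℝ)) := by positivity
  unfold lyapunovWeight; linarith

theorem continuous_lyapunovWeight : Continuous (lyapunovWeight (ι := ι)) := by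
  unfold lyapunovWeight; fun_prop

variable {A : EuclideanSpace ℝ ι →L[ℝ] EuclideanSpace ℝ ι} {ν : Measure (EuclideanSpace ℝ ι)}
  [IsProbabilityMeasure ν]

theorem IsDefectGaussian.integral_lyapunovWeight_le [Nonempty ι] (hν : IsDefectGaussian A ν)
    (hA : ‖A‖ ≤ 1) (b : EuclideanSpace ℝ ι) :
    Integrable (fun x => lyapunovWeight (b + x)) ν ∧
      ∫ x, lyapunovWeight (b + x) ∂ν ≤ 1 + 1 / 2048 * (‖b‖ ^ 2 / Fintype.card ι + 1) := by
  have hn : (0 : ℝ) < Fintype.card ι := by exact_mod_cast Fintype.card_pos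
  obtain ⟨h1, h2⟩ := hν.integral_norm_add_sq_le hA b
  have h3 : Integrable (fun x => 1 / 2048 * (‖b + x‖ ^ 2 / (Fintype.card ι : ℝ))) ν :=
    (h1.div_const _).const_mul _
  refine ⟨(integrable_const _).add h3, ?_⟩
  unfold lyapunovWeight
  rw [integral_add (integrable_const _) h3, integral_const_mul, integral_div]
  simp only [integral_const, probReal_univ, smul_eq_mul, one_mul]
  gcongr
  rw [div_add_one hn.ne']
  gcongr

/-- One step of the chain: the weighted exponential moment contracts. -/
theorem IsDefectGaussian.lintegral_step_le [Nonempty ι] (hν : IsDefectGaussian A ν)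
    (hA : ‖A‖ ≤ 1 / 2) (M : ι → ι → ℝ) (hM : ∀ a b, M a b = M b a)
    (hM1 : 1 ≤ ∑ a, ∑ b, M a b ^ 2) (c : ℝ) {b y : EuclideanSpace ℝ ι} (hby : ‖b‖ ≤ 1 / 2 * ‖y‖) :
    ∫⁻ x, ENNReal.ofReal (lyapunovWeight (b + x) *
        Real.exp (-(4 * truncSq (fun z => quadForm M z + c) (b + x)))) ∂ν ≤
      ENNReal.ofReal ((1 - 1 / 8192) * lyapunovWeight y) := by
  have hA1 : ‖A‖ ≤ 1 := hA.trans (by norm_num)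
  have hn : (0 : ℝ) < Fintype.card ι := by exact_mod_cast Fintype.card_pos
  obtain ⟨hi1, hi2⟩ := hν.integral_lyapunovWeight_le hA1 b
  obtain ⟨hj1, hj2⟩ := hν.integral_norm_add_sq_le hA1 b
  set g : EuclideanSpace ℝ ι → ℝ := fun z => quadForm M z + c
  have hgm : Measurable g := ((continuous_quadForm M).add continuous_const).measurable
  have hadd : Measurable fun x : EuclideanSpace ℝ ι => b + x := by fun_prop
  set F : EuclideanSpace ℝ ι → ℝ :=
    fun x => lyapunovWeight (b + x) * Real.exp (-(4 * truncSq g (b + x))) with hF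
  have hFm : Measurable F :=
    (continuous_lyapunovWeight.measurable.comp hadd).mul
      ((((measurable_truncSq hgm).comp hadd).const_mul 4).neg.exp)
  have hF0 : ∀ x, 0 ≤ F x := fun x =>
    mul_nonneg (zero_le_one.trans (one_le_lyapunovWeight _)) (Real.exp_pos _).le
  have hFle : ∀ x, F x ≤ lyapunovWeight (b + x) := fun x => by
    refine mul_le_of_le_one_right (zero_le_one.trans (one_le_lyapunovWeight _)) ?_
    have := truncSq_nonneg g (b + x)
    exact Real.exp_le_one_iff.mpr (by linarith)
  have hFi : Integrable F ν := hi1.mono' hFm.aestronglyMeasurable (.of_forall fun x => by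
    rw [Real.norm_of_nonneg (hF0 x)]; exact hFle x)
  rw [← ofReal_integral_eq_lintegral_ofReal hFi (.of_forall hF0)]
  refine ENNReal.ofReal_le_ofReal ?_
  set V : ℝ := ‖y‖ ^ 2 / Fintype.card ι with hV
  have hbV : ‖b‖ ^ 2 / Fintype.card ι ≤ V / 4 := by
    rw [hV, div_div, mul_comm, ← div_div]
    gcongr
    calc ‖b‖ ^ 2 ≤ (1 / 2 * ‖y‖) ^ 2 := by gcongr
      _ = ‖y‖ ^ 2 / 4 := by ring
  have hPsi : ∫ x, lyapunovWeight (b + x) ∂ν ≤ 1 + 1 / 2048 * (V / 4 + 1) := by linarith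
  have hWy : lyapunovWeight y = 1 + 1 / 2048 * V := rfl
  -- Far from the origin the drift of the weight contracts by itself; near the origin the weight may
  -- grow and the small-ball estimate compensates.
  rcases le_total 2 V with h2 | h2
  · have := (integral_mono hFi hi1 hFle).trans hPsi
    rw [hWy]; linarith
  · have hV0 : 0 ≤ V := by positivity
    set G : Set (EuclideanSpace ℝ ι) := {x | 1 / 4 ≤ g (b + x) ^ 2}
    set Bd : Set (EuclideanSpace ℝ ι) := {x | 384 * Fintype.card ι ≤ ‖b + x‖ ^ 2}
    have hG : MeasurableSet G := measurableSet_le measurable_const ((hgm.comp hadd).pow_const 2)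
    have hBd : MeasurableSet Bd := measurableSet_le measurable_const (by fun_prop)
    have hG1 : 1 / 128 ≤ ν.real G := hν.quadForm_smallBall hA M hM hM1 b c
    -- Markov: for `V ≤ 2` the second moment is at most `3n/2`, and `(3/2)/384 = 1/256` is half of
    -- the small-ball probability.
    have hBd1 : ν.real Bd ≤ 1 / 256 := by
      have h := mul_meas_ge_le_integral_of_nonneg (μ := ν) (f := fun x => ‖b + x‖ ^ 2)
        (.of_forall fun x => sq_nonneg _) hj1 (384 * Fintype.card ι)
      have hb2 : ‖b‖ ^ 2 ≤ 1 / 2 * Fintype.card ι := by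
        rw [div_le_iff₀ hn] at hbV
        nlinarith
      have h' : 384 * Fintype.card ι * ν.real Bd ≤ 384 * Fintype.card ι * (1 / 256) :=
        (h.trans hj2).trans (by linarith)
      exact le_of_mul_le_mul_left h' (by positivity)
    have hGB : 1 / 256 ≤ ν.real (G \ Bd) := by
      have := measureReal_mono (μ := ν) (s₁ := G) (s₂ := (G \ Bd) ∪ Bd) (by
        rw [Set.sdiff_union_self]; exact Set.subset_union_left)
      have := this.trans (measureReal_union_le _ _)
      linarith
    -- On `G \ Bd` the exponential factor is at most `e⁻¹ ≤ 1/2` while the weight is at least `1`,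
    -- so at least `1/2` is saved. The expected saving `1/512` beats the possible growth, of order
    -- `1/2048`.
    have hpt : ∀ x, F x ≤ lyapunovWeight (b + x) - (G \ Bd).indicator (fun _ => (1 / 2 : ℝ)) x := by
      intro x
      by_cases hx : x ∈ G \ Bd
      · rw [Set.indicator_of_mem hx]
        have hx1 : 1 / 4 ≤ g (b + x) ^ 2 := hx.1
        have hx2 : ‖b + x‖ ^ 2 ≤ 384 * Fintype.card ι := (not_le.mp hx.2).le
        have ht : truncSq g (b + x) = g (b + x) ^ 2 := if_pos hx2
        have he : Real.exp (-(4 * truncSq g (b + x))) ≤ 1 / 2 := by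
          rw [ht]
          calc Real.exp (-(4 * g (b + x) ^ 2)) ≤ Real.exp (-1) :=
                Real.exp_le_exp.mpr (by linarith)
            _ ≤ 1 / 2 := by
                have := Real.exp_neg_one_lt_d9
                linarith
        have h1 := one_le_lyapunovWeight (b + x)
        have : F x ≤ lyapunovWeight (b + x) * (1 / 2) := by
          simp only [hF]; gcongr
        linarith
      · rw [Set.indicator_of_notMem hx, sub_zero]; exact hFle x
    have hind : Integrable ((G \ Bd).indicator fun _ => (1 / 2 : ℝ)) ν :=
      (integrable_const _).indicator (hG.diff hBd)
    have h := integral_mono hFi (hi1.sub hind) hpt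
    simp only [Pi.sub_apply] at h
    rw [integral_sub hi1 hind, integral_indicator (hG.diff hBd), setIntegral_const,
      smul_eq_mul] at h
    rw [hWy]
    linarith

end OneStep
end

/-! ### Law and independence of the trajectory, and exponential moments along a progression of times
-/

noncomputable section
open scoped RealInnerProductSpace

/-- Extension by zero of a finite family of noise vectors to a noise sequence. -/
def extendNoise {E : Type*} [Zero E] (S : Finset ℕ) (l : ℕ) (t : S → E) : E :=
  if h : l ∈ S then t ⟨l, h⟩ else 0

theorem measurable_extendNoise {E : Type*} [Zero E] [MeasurableSpace E] (S : Finset ℕ) (l : ℕ) :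
    Measurable (extendNoise (E := E) S l) := by
  unfold extendNoise
  split_ifs
  · exact measurable_pi_apply _
  · exact measurable_const

theorem charFun_map_clm {Ω E : Type*} [MeasurableSpace Ω] {μ : Measure Ω}
    [NormedAddCommGroup E] [InnerProductSpace ℝ E] [CompleteSpace E] [MeasurableSpace E]
    [BorelSpace E] [SecondCountableTopology E] (T : E →L[ℝ] E) {X : Ω → E} (hX : Measurable X)
    (t : E) :
    charFun (μ.map fun ω => T (X ω)) t = charFun (μ.map X) (ContinuousLinearMap.adjoint T t) := by
  rw [charFun_apply, charFun_apply, integral_map (by fun_prop) (by fun_prop),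
    integral_map hX.aemeasurable (by fun_prop)]
  simp_rw [ContinuousLinearMap.adjoint_inner_right]

theorem lintegral_indepFun {Ω E γ : Type*} [MeasurableSpace Ω] [MeasurableSpace E]
    [MeasurableSpace γ] {μ : Measure Ω} [IsProbabilityMeasure μ] {U : Ω → γ} {X : Ω → E}
    (hU : Measurable U) (hX : Measurable X) (hUX : IndepFun U X μ) {f : γ × E → ENNReal}
    (hf : Measurable f) :
    ∫⁻ ω, f (U ω, X ω) ∂μ = ∫⁻ ω, ∫⁻ x, f (U ω, x) ∂(μ.map X) ∂μ := by
  have : IsProbabilityMeasure (μ.map X) := Measure.isProbabilityMeasure_map hX.aemeasurable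
  have h := (indepFun_iff_map_prod_eq_prod_map_map hU.aemeasurable hX.aemeasurable).mp hUX
  rw [← lintegral_map (g := fun ω => (U ω, X ω)) hf (hU.prodMk hX), h,
    lintegral_prod _ hf.aemeasurable,
    lintegral_map hf.lintegral_prod_right' hU]

theorem norm_adjoint_le_one {E : Type*} [NormedAddCommGroup E] [InnerProductSpace ℝ E]
    [CompleteSpace E] {D V : E →L[ℝ] E}
    (hDV : ∀ t, ‖ContinuousLinearMap.adjoint D t‖ ^ 2 + ‖ContinuousLinearMap.adjoint V t‖ ^ 2 =
      ‖t‖ ^ 2) : ‖ContinuousLinearMap.adjoint D‖ ≤ 1 := by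
  refine ContinuousLinearMap.opNorm_le_bound _ zero_le_one fun t => ?_
  have := hDV t
  rw [one_mul]
  exact abs_le_of_sq_le_sq' (by nlinarith [sq_nonneg ‖ContinuousLinearMap.adjoint V t‖])
    (norm_nonneg _) |>.2

theorem adjoint_pow {E : Type*} [NormedAddCommGroup E] [InnerProductSpace ℝ E]
    [CompleteSpace E] (D : E →L[ℝ] E) (j : ℕ) :
    ContinuousLinearMap.adjoint D ^ j = ContinuousLinearMap.adjoint (D ^ j) := by
  simp only [← ContinuousLinearMap.star_eq_adjoint, star_pow]

section LinState

variable {Ω : Type*} {E : Type*} [NormedAddCommGroup E] [InnerProductSpace ℝ E]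

/-- The trajectory of `Y (k + 1) = D (Y k) + V (W k)` started at zero. -/
def linState (D V : E →L[ℝ] E) (W : ℕ → Ω → E) : ℕ → Ω → E
  | 0, _ => 0
  | k + 1, ω => D (linState D V W k ω) + V (W k ω)

theorem linState_add (D V : E →L[ℝ] E) (W : ℕ → Ω → E) (k j : ℕ) (ω : Ω) :
    linState D V W (k + j) ω =
      (D ^ j) (linState D V W k ω) + linState D V (fun l => W (k + l)) j ω := by
  induction j with
  | zero => simp [linState]
  | succ j ih =>
    rw [← add_assoc, linState, ih, linState, map_add, pow_succ', add_assoc]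
    rfl

/-- The state at time `k` uses only the first `k` noises. With `extendNoise` it becomes a function
of a finite block of noise, the form in which independence of disjoint blocks applies. -/
theorem linState_comp {Ω' : Type*} (D V : E →L[ℝ] E) (W : ℕ → Ω → E) (W' : ℕ → Ω' → E)
    (f : Ω → Ω') (k : ℕ) (ω : Ω) (h : ∀ l < k, W l ω = W' l (f ω)) :
    linState D V W k ω = linState D V W' k (f ω) := by
  induction k with
  | zero => rfl
  | succ k ih =>
    rw [linState, linState, ih fun l hl => h l (hl.trans k.lt_succ_self), h k k.lt_succ_self]

variable [FiniteDimensional ℝ E] [MeasurableSpace E] [BorelSpace E] [MeasurableSpace Ω]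

theorem measurable_linState (D V : E →L[ℝ] E) {W : ℕ → Ω → E} (hW : ∀ k, Measurable (W k))
    (k : ℕ) : Measurable (linState D V W k) := by
  induction k with
  | zero => exact measurable_const
  | succ k ih => exact (D.measurable.comp ih).add (V.measurable.comp (hW k))

variable {μ : Measure Ω} {D V : E →L[ℝ] E} {W : ℕ → Ω → E}

/-- Any function of the trajectory up to time `k` is independent of the noise accumulated
after time `k`. -/
theorem indepFun_linState (hW : ∀ k, Measurable (W k)) (hind : iIndepFun W μ) (k j : ℕ)
    {γ : Type*} [MeasurableSpace γ] {f : (ℕ → E) → γ} (hf : Measurable f)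
    (hfk : ∀ u v : ℕ → E, (∀ l ≤ k, u l = v l) → f u = f v) :
    IndepFun (fun ω => f fun l => linState D V W l ω)
      (linState D V (fun l => W (k + l)) j) μ := by
  have h := hind.indepFun_finset (Finset.range k) (Finset.Ico k (k + j))
    (by rw [Finset.disjoint_left]; intro a ha hb; simp at ha hb; omega) hW
  have hφ : Measurable fun t : (Finset.range k) → E =>
      f fun l => linState D V (extendNoise (Finset.range k)) l t :=
    hf.comp (measurable_pi_lambda _ fun l => measurable_linState D V
      (fun i => measurable_extendNoise _ i) l)
  have hψ : Measurable fun t : (Finset.Ico k (k + j)) → E =>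
      linState D V (fun l => extendNoise (Finset.Ico k (k + j)) (k + l)) j t :=
    measurable_linState D V (fun i => measurable_extendNoise _ _) j
  have h2 := h.comp hφ hψ
  convert h2 using 1
  · ext ω
    refine hfk _ _ fun l hl => ?_
    refine linState_comp D V W _ (fun ω (i : Finset.range k) => W i ω) l ω fun i hi => ?_
    simp [extendNoise, hi.trans_le hl]
  · ext ω
    refine linState_comp D V _ _ (fun ω (i : Finset.Ico k (k + j)) => W i ω) j ω fun i hi => ?_
    simp [extendNoise, hi]

/-- The variances telescope: `(‖D*t‖² - ‖D*^(j+1) t‖²) + ‖V*t‖² = ‖t‖² - ‖D*^(j+1) t‖²`. -/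
theorem isDefectGaussian_linState [IsProbabilityMeasure μ] (hW : ∀ k, Measurable (W k))
    (hind : iIndepFun W μ)
    (hlaw : ∀ k, μ.map (W k) = stdGaussian E)
    (hDV : ∀ t, ‖ContinuousLinearMap.adjoint D t‖ ^ 2 + ‖ContinuousLinearMap.adjoint V t‖ ^ 2 =
      ‖t‖ ^ 2) (j : ℕ) :
    IsDefectGaussian (ContinuousLinearMap.adjoint D ^ j) (μ.map (linState D V W j)) := by
  induction j with
  | zero =>
    intro t
    have : linState D V W 0 = fun _ => 0 := rfl
    rw [this, Measure.map_const]
    simp [defectForm, charFun_dirac]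
  | succ j ih =>
    intro t
    have hm := measurable_linState D V hW
    have hi : IndepFun (linState D V W j) (W j) μ := by
      have h := hind.indepFun_finset (Finset.range j) {j} (by simp) hW
      have hψ : Measurable fun t : ({j} : Finset ℕ) → E => t ⟨j, by simp⟩ := measurable_pi_apply _
      have h2 := h.comp (φ := fun t => linState D V (extendNoise (Finset.range j)) j t)
        (measurable_linState D V (fun i => measurable_extendNoise _ i) j) hψ
      convert h2 using 1
      · ext ω
        refine linState_comp D V W _ (fun ω (i : Finset.range j) => W i ω) j ω fun i hi => ?_
        simp [extendNoise, hi]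
      · rfl
    have hi2 : IndepFun (fun ω => D (linState D V W j ω)) (fun ω => V (W j ω)) μ :=
      hi.comp D.measurable V.measurable
    have e : linState D V W (j + 1) = fun ω => D (linState D V W j ω) + V (W j ω) := rfl
    have hDm : Measurable fun ω => D (linState D V W j ω) := D.measurable.comp (hm j)
    have hVm : Measurable fun ω => V (W j ω) := V.measurable.comp (hW j)
    rw [e, hi2.charFun_map_fun_add_eq_mul hDm.aemeasurable hVm.aemeasurable, Pi.mul_apply,
      charFun_map_clm D (hm j),
      charFun_map_clm V (hW j), ih, hlaw, charFun_stdGaussian, ← Complex.ofReal_pow,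
      ← Complex.ofReal_neg, ← Complex.ofReal_ofNat, ← Complex.ofReal_div, ← Complex.exp_add,
      ← Complex.ofReal_add]
    congr 2
    have := hDV t
    simp only [defectForm, pow_succ]
    change _ = -(‖t‖ ^ 2 - ‖(ContinuousLinearMap.adjoint D ^ j)
      (ContinuousLinearMap.adjoint D t)‖ ^ 2) / 2
    rw [← this]
    ring

end LinState

section Chain

variable {Ω : Type*} [MeasurableSpace Ω] {μ : Measure Ω} [IsProbabilityMeasure μ]
  {ι : Type*} [Fintype ι] [Nonempty ι]
  {D V : EuclideanSpace ℝ ι →L[ℝ] EuclideanSpace ℝ ι} {W : ℕ → Ω → EuclideanSpace ℝ ι}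

/-- Exponential moment of the truncated squares along an arithmetic progression of times. -/
theorem lintegral_chain_le (hW : ∀ k, Measurable (W k)) (hind : iIndepFun W μ)
    (hlaw : ∀ k, μ.map (W k) = stdGaussian (EuclideanSpace ℝ ι))
    (hDV : ∀ t, ‖ContinuousLinearMap.adjoint D t‖ ^ 2 + ‖ContinuousLinearMap.adjoint V t‖ ^ 2 =
      ‖t‖ ^ 2) {j : ℕ} (hj : ‖D ^ j‖ ≤ 1 / 2) (M : ι → ι → ℝ) (hM : ∀ a b, M a b = M b a)
    (hM1 : 1 ≤ ∑ a, ∑ b, M a b ^ 2) (c : ℝ) (r m : ℕ) :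
    ∫⁻ ω, ENNReal.ofReal (lyapunovWeight (linState D V W (r + m * j) ω) *
        Real.exp (-(4 * ∑ i ∈ Finset.range m,
          truncSq (fun z => quadForm M z + c) (linState D V W (r + (i + 1) * j) ω)))) ∂μ ≤
      ENNReal.ofReal (2 * (1 - 1 / 8192) ^ m) := by
  set g : EuclideanSpace ℝ ι → ℝ := fun z => quadForm M z + c
  have hgm : Measurable g := ((continuous_quadForm M).add continuous_const).measurable
  have htm := measurable_truncSq hgm
  have hYm := measurable_linState D V hW
  induction m with
  | zero =>
    -- The chain starts at zero, so the mean weight at time `r` is at most `1 + 1/2048`; this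
    -- accounts for the prefactor `2`.
    have hν := isDefectGaussian_linState hW hind hlaw hDV r
    have : IsProbabilityMeasure (μ.map (linState D V W r)) :=
      Measure.isProbabilityMeasure_map (hYm r).aemeasurable
    obtain ⟨h1, h2⟩ := hν.integral_lyapunovWeight_le
      ((norm_pow_le _ _).trans (pow_le_one₀ (norm_nonneg _) (norm_adjoint_le_one hDV))) 0
    simp only [zero_mul, add_zero, Finset.range_zero, Finset.sum_empty, mul_zero, neg_zero,
      Real.exp_zero, mul_one, pow_zero]
    rw [← lintegral_map (f := fun y => ENNReal.ofReal (lyapunovWeight y))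
      (continuous_lyapunovWeight.measurable.ennreal_ofReal) (hYm r)]
    simp only [zero_add] at h1 h2
    rw [← ofReal_integral_eq_lintegral_ofReal h1
      (.of_forall fun x => zero_le_one.trans (one_le_lyapunovWeight _))]
    refine ENNReal.ofReal_le_ofReal (h2.trans ?_)
    norm_num
  | succ m ih =>
    set k := r + m * j with hk
    have hkj : r + (m + 1) * j = k + j := by rw [hk]; ring
    set W' : ℕ → Ω → EuclideanSpace ℝ ι := fun l => W (k + l)
    have hW' : ∀ l, Measurable (W' l) := fun l => hW _
    have hind' : iIndepFun W' μ := hind.precomp (add_right_injective k)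
    have hν : IsDefectGaussian (ContinuousLinearMap.adjoint D ^ j) (μ.map (linState D V W' j)) :=
      isDefectGaussian_linState hW' hind' (fun l => hlaw _) hDV j
    have : IsProbabilityMeasure (μ.map (linState D V W' j)) :=
      Measure.isProbabilityMeasure_map (measurable_linState D V hW' j).aemeasurable
    have hAj : ‖ContinuousLinearMap.adjoint D ^ j‖ ≤ 1 / 2 := by
      rw [adjoint_pow]; simpa using hj
    set G : (ℕ → EuclideanSpace ℝ ι) → ℝ := fun u =>
      Real.exp (-(4 * ∑ i ∈ Finset.range m, truncSq g (u (r + (i + 1) * j)))) with hG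
    have hGm : Measurable G := by
      refine ((Finset.measurable_sum _ fun i _ => ?_).const_mul 4).neg.exp
      exact htm.comp (measurable_pi_apply _)
    -- The past exponential factor and the current state depend only on the trajectory up to `k`, so
    -- the noise of the next `j` steps can be integrated first with both frozen.
    have hUX := indepFun_linState (D := D) (V := V) hW hind k j (f := fun u => (G u, u k))
      (hGm.prodMk (measurable_pi_apply k)) (fun u v h => by
        refine Prod.ext ?_ (h k le_rfl)
        simp only [hG]
        congr 3
        refine Finset.sum_congr rfl fun i hi => ?_
        rw [h]
        rw [hk]
        gcongr
        exact Finset.mem_range.mp hi)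
    set f : (ℝ × EuclideanSpace ℝ ι) × EuclideanSpace ℝ ι → ENNReal := fun p =>
      ENNReal.ofReal p.1.1 * ENNReal.ofReal (lyapunovWeight ((D ^ j) p.1.2 + p.2) *
        Real.exp (-(4 * truncSq g ((D ^ j) p.1.2 + p.2)))) with hf
    have hfm : Measurable f := by
      have h0 : Measurable fun p : (ℝ × EuclideanSpace ℝ ι) × EuclideanSpace ℝ ι =>
        (D ^ j) p.1.2 + p.2 := by fun_prop
      refine (by fun_prop : Measurable fun p : (ℝ × EuclideanSpace ℝ ι) × EuclideanSpace ℝ ι =>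
        ENNReal.ofReal p.1.1).mul (Measurable.ennreal_ofReal ?_)
      exact (continuous_lyapunovWeight.measurable.comp h0).mul
        (((htm.comp h0).const_mul 4).neg.exp)
    have hUm : Measurable fun ω => (G fun l => linState D V W l ω, linState D V W k ω) :=
      (hGm.comp (measurable_pi_lambda _ fun l => hYm l)).prodMk (hYm k)
    have hGpos : ∀ u, 0 ≤ G u := fun u => (Real.exp_pos _).le
    calc _ = ∫⁻ ω, f ((G fun l => linState D V W l ω, linState D V W k ω),
            linState D V W' j ω) ∂μ := by
          refine lintegral_congr fun ω => ?_
          have hst : linState D V W (k + j) ω =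
            (D ^ j) (linState D V W k ω) + linState D V W' j ω := linState_add D V W k j ω
          simp only [hf]
          rw [← ENNReal.ofReal_mul (hGpos fun l => linState D V W l ω), ← hst, hkj,
            Finset.sum_range_succ, hkj, mul_add, neg_add, Real.exp_add]
          congr 1
          simp only [hG]
          ring
      _ = ∫⁻ ω, ∫⁻ x, f ((G fun l => linState D V W l ω, linState D V W k ω), x)
            ∂(μ.map (linState D V W' j)) ∂μ :=
          lintegral_indepFun hUm (measurable_linState D V hW' j) hUX hfm
      _ ≤ ∫⁻ ω, ENNReal.ofReal (1 - 1 / 8192) * ENNReal.ofReal (lyapunovWeight (linState D V W k ω)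
            * G fun l => linState D V W l ω) ∂μ := by
          refine lintegral_mono fun ω => ?_
          simp only [hf]
          rw [lintegral_const_mul' _ _ ENNReal.ofReal_ne_top]
          have hb : ‖(D ^ j) (linState D V W k ω)‖ ≤ 1 / 2 * ‖linState D V W k ω‖ :=
            ((D ^ j).le_opNorm _).trans (by gcongr)
          refine (mul_le_mul_right (hν.lintegral_step_le hAj M hM hM1 c hb) _).trans (le_of_eq ?_)
          rw [← ENNReal.ofReal_mul (hGpos fun l => linState D V W l ω),
            ← ENNReal.ofReal_mul (by norm_num)]
          congr 1
          ring
      _ ≤ ENNReal.ofReal (1 - 1 / 8192) * ENNReal.ofReal (2 * (1 - 1 / 8192) ^ m) := by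
          rw [lintegral_const_mul' _ _ ENNReal.ofReal_ne_top]
          exact mul_le_mul_right ih _
      _ = _ := by
          rw [← ENNReal.ofReal_mul (by norm_num)]
          congr 1
          ring

end Chain
end

/-! ### Integrals over Euclidean balls -/

noncomputable section
open scoped RealInnerProductSpace

section Ball

variable {F : Type*} [NormedAddCommGroup F] [InnerProductSpace ℝ F] [FiniteDimensional ℝ F]
  [MeasurableSpace F] [BorelSpace F]

theorem integrableOn_ball_of_continuous {f : F → ℝ} (hf : Continuous f) (x : F) (r : ℝ) :
    IntegrableOn f (Metric.ball x r) :=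
  (hf.continuousOn.integrableOn_compact (isCompact_closedBall x r)).mono_set
    Metric.ball_subset_closedBall

theorem setIntegral_ball_comp_isometry (R : F ≃ₗᵢ[ℝ] F) (f : F → ℝ) (r : ℝ) :
    ∫ w in Metric.ball (0 : F) r, f (R w) = ∫ w in Metric.ball (0 : F) r, f w := by
  have h := R.measurePreserving.setIntegral_preimage_emb
    R.toHomeomorph.measurableEmbedding f (Metric.ball 0 r)
  have e : R ⁻¹' Metric.ball (0 : F) r = Metric.ball 0 r := by
    ext w; simp
  rw [e] at h
  exact h

/-- The reflection exchanging `x` and `y` preserves the ball and the volume. -/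
theorem setIntegral_ball_inner_sq_congr {x y : F} (h : ‖x‖ = ‖y‖) (r : ℝ) :
    ∫ w in Metric.ball (0 : F) r, ⟪w, x⟫ ^ 2 = ∫ w in Metric.ball (0 : F) r, ⟪w, y⟫ ^ 2 := by
  have hR := Submodule.reflection_sub h
  set R := (ℝ ∙ (x - y))ᗮ.reflection
  rw [← setIntegral_ball_comp_isometry R (fun w => ⟪w, y⟫ ^ 2) r]
  simp_rw [← hR, R.inner_map_map]

/-- The second moment of a linear functional over a centered ball. -/
theorem setIntegral_ball_inner_sq_le (x : F) {r : ℝ} :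
    Module.finrank ℝ F * ∫ w in Metric.ball (0 : F) r, ⟪w, x⟫ ^ 2 ≤
      volume.real (Metric.ball (0 : F) r) * (r ^ 2 * ‖x‖ ^ 2) := by
  set b := stdOrthonormalBasis ℝ F
  have h1 : ∀ i, ∫ w in Metric.ball (0 : F) r, ⟪w, x⟫ ^ 2 =
      ‖x‖ ^ 2 * ∫ w in Metric.ball (0 : F) r, ⟪b i, w⟫ ^ 2 := by
    intro i
    rw [setIntegral_ball_inner_sq_congr (y := ‖x‖ • b i) (by simp [norm_smul]),
      ← integral_const_mul]
    simp_rw [inner_smul_right, mul_pow, real_inner_comm]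
  -- All directions of equal length have the same second moment, so summing over an orthonormal
  -- basis produces `‖w‖²`. This gains the factor `1/dim` on which the uniform bound relies.
  have h2 : Module.finrank ℝ F * ∫ w in Metric.ball (0 : F) r, ⟪w, x⟫ ^ 2 =
      ‖x‖ ^ 2 * ∫ w in Metric.ball (0 : F) r, ‖w‖ ^ 2 := by
    calc _ = ∑ _i : Fin (Module.finrank ℝ F), ∫ w in Metric.ball (0 : F) r, ⟪w, x⟫ ^ 2 := by simp
      _ = ∑ i, ‖x‖ ^ 2 * ∫ w in Metric.ball (0 : F) r, ⟪b i, w⟫ ^ 2 :=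
          Finset.sum_congr rfl fun i _ => h1 i
      _ = _ := by
        rw [← Finset.mul_sum, ← integral_finsetSum _ fun i _ =>
          integrableOn_ball_of_continuous (by fun_prop) _ _]
        simp_rw [b.sum_sq_inner_right]
  have h3 : ∫ w in Metric.ball (0 : F) r, ‖w‖ ^ 2 ≤ ∫ _w in Metric.ball (0 : F) r, r ^ 2 := by
    refine setIntegral_mono_on (integrableOn_ball_of_continuous (by fun_prop) _ _)
      (integrableOn_ball_of_continuous continuous_const _ _) Metric.isOpen_ball.measurableSet
      fun w hw => ?_
    have := mem_ball_zero_iff.mp hw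
    gcongr
  rw [setIntegral_const, smul_eq_mul] at h3
  rw [h2]
  nlinarith [sq_nonneg ‖x‖]

theorem setIntegral_ball_inner (x : F) (r : ℝ) :
    ∫ w in Metric.ball (0 : F) r, ⟪w, x⟫ = 0 := by
  have h := setIntegral_ball_comp_isometry (LinearIsometryEquiv.neg ℝ (E := F))
    (fun w => ⟪w, x⟫) r
  simp only [LinearIsometryEquiv.coe_neg, inner_neg_left, integral_neg] at h
  linarith

/-- Lower bound for a Gaussian-type integral over a small ball, by Jensen's inequality. -/
theorem le_setIntegral_ball_exp [Nontrivial F] {κ : Type*} (s : Finset κ) (a : κ → ℝ)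
    (ha : ∀ k ∈ s, 0 ≤ a k) (φ : κ → F) (u : F) {r : ℝ} (hr : 0 < r) :
    volume.real (Metric.ball (0 : F) r) *
        Real.exp (-∑ k ∈ s, a k * (⟪u, φ k⟫ ^ 2 + r ^ 2 * ‖φ k‖ ^ 2 / Module.finrank ℝ F)) ≤
      ∫ w in Metric.ball (0 : F) r, Real.exp (-∑ k ∈ s, a k * ⟪u + w, φ k⟫ ^ 2) := by
  set Bl := Metric.ball (0 : F) r
  have hvol : 0 < volume.real Bl :=
    ENNReal.toReal_pos (Metric.measure_ball_pos _ _ hr).ne' measure_ball_lt_top.ne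
  have hd : (0 : ℝ) < Module.finrank ℝ F := by exact_mod_cast Module.finrank_pos
  have hcont : Continuous fun w : F => -∑ k ∈ s, a k * ⟪u + w, φ k⟫ ^ 2 := by fun_prop
  have hJ := convexOn_exp.map_set_average_le (μ := volume) (t := Bl)
    (f := fun w => -∑ k ∈ s, a k * ⟪u + w, φ k⟫ ^ 2) Real.continuous_exp.continuousOn isClosed_univ
    (Metric.measure_ball_pos _ _ hr).ne' measure_ball_lt_top.ne (by simp)
    (integrableOn_ball_of_continuous hcont _ _)
    (integrableOn_ball_of_continuous (Real.continuous_exp.comp hcont) _ _)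
  rw [setAverage_eq, setAverage_eq, smul_eq_mul, smul_eq_mul] at hJ
  have hI : ∀ k, ∫ w in Bl, ⟪u + w, φ k⟫ ^ 2 ≤
      volume.real Bl * (⟪u, φ k⟫ ^ 2 + r ^ 2 * ‖φ k‖ ^ 2 / Module.finrank ℝ F) := by
    intro k
    have e : ∀ w, ⟪u + w, φ k⟫ ^ 2 = ⟪u, φ k⟫ ^ 2 + 2 * ⟪u, φ k⟫ * ⟪w, φ k⟫ + ⟪w, φ k⟫ ^ 2 := by
      intro w; rw [inner_add_left]; ring
    have i1 : IntegrableOn (fun w : F => ⟪u, φ k⟫ ^ 2 + 2 * ⟪u, φ k⟫ * ⟪w, φ k⟫) Bl :=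
      integrableOn_ball_of_continuous (by fun_prop) _ _
    have i2 : IntegrableOn (fun w : F => ⟪w, φ k⟫ ^ 2) Bl :=
      integrableOn_ball_of_continuous (by fun_prop) _ _
    have i3 : IntegrableOn (fun w : F => 2 * ⟪u, φ k⟫ * ⟪w, φ k⟫) Bl :=
      integrableOn_ball_of_continuous (by fun_prop) _ _
    have i4 : IntegrableOn (fun _ : F => ⟪u, φ k⟫ ^ 2) Bl :=
      integrableOn_ball_of_continuous (by fun_prop) _ _
    simp_rw [e]
    rw [integral_add i1 i2, integral_add i4 i3, integral_const_mul, setIntegral_ball_inner,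
      setIntegral_const, smul_eq_mul, mul_zero, add_zero, mul_add]
    gcongr
    rw [mul_div_assoc', le_div_iff₀ hd, mul_comm]
    exact setIntegral_ball_inner_sq_le (φ k)
  have hQ : ∫ w in Bl, -∑ k ∈ s, a k * ⟪u + w, φ k⟫ ^ 2 ≥ volume.real Bl *
      -∑ k ∈ s, a k * (⟪u, φ k⟫ ^ 2 + r ^ 2 * ‖φ k‖ ^ 2 / Module.finrank ℝ F) := by
    rw [integral_neg, integral_finsetSum _ fun k _ =>
      integrableOn_ball_of_continuous (by fun_prop) _ _, mul_neg, Finset.mul_sum]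
    refine neg_le_neg (Finset.sum_le_sum fun k hk => ?_)
    rw [integral_const_mul, mul_left_comm]
    exact mul_le_mul_of_nonneg_left (hI k) (ha k hk)
  rw [← le_div_iff₀' hvol, div_eq_inv_mul]
  refine le_trans (Real.exp_le_exp.mpr ?_) hJ
  rw [inv_mul_eq_div, le_div_iff₀' hvol]
  exact hQ

theorem setIntegral_ball_translate (f : F → ℝ) (u : F) (r : ℝ) :
    ∫ w in Metric.ball (0 : F) r, f (u + w) = ∫ v in Metric.ball u r, f v := by
  have h := (measurePreserving_add_left (volume : Measure F) u).setIntegral_preimage_emb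
    (measurableEmbedding_addLeft u) f (Metric.ball u r)
  rw [← h]
  congr 2
  ext w
  simp

end Ball
end

/-! ### From one direction to all directions: averaging over a shell -/

noncomputable section
open scoped RealInnerProductSpace

section Feature

variable {ι : Type*} [Fintype ι]

/-- The feature `y yᵀ + H`, as a vector indexed by all pairs. -/
def pairFeature (H : EuclideanSpace ℝ (ι × ι)) (y : EuclideanSpace ℝ ι) :
    EuclideanSpace ℝ (ι × ι) := WithLp.toLp 2 (fun p => y p.1 * y p.2) + H

theorem continuous_pairFeature (H : EuclideanSpace ℝ (ι × ι)) : Continuous (pairFeature H) := by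
  unfold pairFeature; fun_prop

theorem inner_pairFeature (H v : EuclideanSpace ℝ (ι × ι)) (y : EuclideanSpace ℝ ι) :
    ⟪v, pairFeature H y⟫ = quadForm (fun a b => v (a, b)) y + ⟪v, H⟫ := by
  rw [pairFeature, inner_add_right]
  congr 1
  simp only [quadForm, PiLp.inner_apply, RCLike.inner_apply, conj_trivial, Fintype.sum_prod_type]
  exact Finset.sum_congr rfl fun a _ => Finset.sum_congr rfl fun b _ => by ring

theorem norm_pairFeature_sq_le (H : EuclideanSpace ℝ (ι × ι)) (y : EuclideanSpace ℝ ι) :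
    ‖pairFeature H y‖ ^ 2 ≤ 2 * (‖y‖ ^ 2) ^ 2 + 2 * ‖H‖ ^ 2 := by
  have h1 : ‖(WithLp.toLp 2 (fun p : ι × ι => y p.1 * y p.2) : EuclideanSpace ℝ (ι × ι))‖ ^ 2 =
      (‖y‖ ^ 2) ^ 2 := by
    rw [EuclideanSpace.real_norm_sq_eq, EuclideanSpace.real_norm_sq_eq, sq (∑ i, _),
      Finset.sum_mul_sum, Fintype.sum_prod_type]
    exact Finset.sum_congr rfl fun a _ => Finset.sum_congr rfl fun b _ => by simp [mul_pow]
  rw [← h1]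
  have h2 := norm_add_le (WithLp.toLp 2 (fun p : ι × ι => y p.1 * y p.2) :
    EuclideanSpace ℝ (ι × ι)) H
  have h3 := pow_le_pow_left₀ (norm_nonneg _) h2 2
  rw [pairFeature]
  nlinarith [sq_nonneg (‖(WithLp.toLp 2 (fun p : ι × ι => y p.1 * y p.2) :
    EuclideanSpace ℝ (ι × ι))‖ - ‖H‖)]

/-- Transposition on vectors indexed by pairs. -/
def pairSwap : EuclideanSpace ℝ (ι × ι) ≃ₗᵢ[ℝ] EuclideanSpace ℝ (ι × ι) :=
  LinearIsometryEquiv.piLpCongrLeft 2 ℝ ℝ (Equiv.prodComm ι ι)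

/-- The symmetric part of a vector indexed by pairs. -/
def pairSymm (v : EuclideanSpace ℝ (ι × ι)) : EuclideanSpace ℝ (ι × ι) :=
  (1 / 2 : ℝ) • (v + pairSwap v)

theorem pairSymm_apply (v : EuclideanSpace ℝ (ι × ι)) (a b : ι) :
    pairSymm v (a, b) = 1 / 2 * (v (a, b) + v (b, a)) := rfl

theorem pairSymm_add (v w : EuclideanSpace ℝ (ι × ι)) :
    pairSymm (v + w) = pairSymm v + pairSymm w := by
  simp only [pairSymm, map_add]; module

theorem norm_pairSymm_le (v : EuclideanSpace ℝ (ι × ι)) : ‖pairSymm v‖ ≤ ‖v‖ := by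
  rw [pairSymm, norm_smul]
  have := norm_add_le v (pairSwap v)
  rw [LinearIsometryEquiv.norm_map] at this
  norm_num
  linarith

theorem pairSymm_of_symm {v : EuclideanSpace ℝ (ι × ι)} (h : ∀ a b, v (a, b) = v (b, a)) :
    pairSymm v = v := by
  ext ⟨a, b⟩
  rw [pairSymm_apply, ← h a b]; ring

theorem continuous_pairSymm : Continuous (pairSymm (ι := ι)) := by
  unfold pairSymm; fun_prop

theorem quadForm_pairSymm (v : EuclideanSpace ℝ (ι × ι)) (y : EuclideanSpace ℝ ι) :
    quadForm (fun a b => pairSymm v (a, b)) y = quadForm (fun a b => v (a, b)) y := by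
  have h : quadForm (fun a b => v (b, a)) y = quadForm (fun a b => v (a, b)) y := by
    unfold quadForm
    rw [Finset.sum_comm]
    exact Finset.sum_congr rfl fun a _ => Finset.sum_congr rfl fun b _ => by ring
  have h2 : quadForm (fun a b => pairSymm v (a, b)) y =
      1 / 2 * (quadForm (fun a b => v (a, b)) y + quadForm (fun a b => v (b, a)) y) := by
    simp only [quadForm, pairSymm_apply, ← Finset.sum_add_distrib, Finset.mul_sum]
    exact Finset.sum_congr rfl fun a _ => Finset.sum_congr rfl fun b _ => by ring
  rw [h2, h]; ring

/-- The quadratic form sees only the symmetric part, and `⟪v, H⟫` is a mere additive constant.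
Directions can thus range over an open subset of all pair-indexed vectors, although the chain
estimate needs a symmetric matrix. -/
theorem truncSq_pairFeature (H v : EuclideanSpace ℝ (ι × ι)) :
    truncSq (fun z => quadForm (fun a b => pairSymm v (a, b)) z + ⟪v, H⟫) =
      truncSq (fun z => ⟪v, pairFeature H z⟫) := by
  congr 1
  ext z
  rw [quadForm_pairSymm, inner_pairFeature]

/-- Sum over the times `r + (i + 1) j` with `r < j` and `i < m`. -/
def blockSum (j m : ℕ) (g : ℕ → ℝ) : ℝ :=
  ∑ p ∈ Finset.range j ×ˢ Finset.range m, g (p.1 + (p.2 + 1) * j)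

theorem blockSum_eq (j m : ℕ) (g : ℕ → ℝ) :
    blockSum j m g = ∑ r ∈ Finset.range j, ∑ i ∈ Finset.range m, g (r + (i + 1) * j) :=
  Finset.sum_product _ _ _

/-- Convexity of `exp`: the block sum divided by `j` is the average over residues of sums along
progressions. No independence between different progressions is needed. -/
theorem exp_blockSum_le {j : ℕ} (hj : 0 < j) (m : ℕ) (g : ℕ → ℝ) :
    Real.exp (-(4 / j * blockSum j m g)) ≤ ∑ r ∈ Finset.range j, (1 / (j : ℝ)) *
      Real.exp (-(4 * ∑ i ∈ Finset.range m, g (r + (i + 1) * j))) := by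
  have hj' : (0 : ℝ) < j := by exact_mod_cast hj
  have h := convexOn_exp.map_sum_le (t := Finset.range j) (w := fun _ => 1 / (j : ℝ))
    (p := fun r => -(4 * ∑ i ∈ Finset.range m, g (r + (i + 1) * j)))
    (fun _ _ => by positivity) (by simp [hj'.ne']) (fun _ _ => Set.mem_univ _)
  simp only [smul_eq_mul] at h
  refine le_trans (le_of_eq ?_) h
  congr 1
  rw [blockSum_eq, ← Finset.mul_sum, Finset.sum_neg_distrib, ← Finset.mul_sum]
  ring

/-- The vectors of norm at most `3` whose symmetric part has norm at least one. -/
def symmShell (ι : Type*) [Fintype ι] : Set (EuclideanSpace ℝ (ι × ι)) :=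
  Metric.ball 0 3 ∩ {v | 1 ≤ ‖pairSymm v‖}

theorem measurableSet_symmShell : MeasurableSet (symmShell ι) :=
  Metric.isOpen_ball.measurableSet.inter
    (measurableSet_le measurable_const continuous_pairSymm.norm.measurable)

/-- Symmetrization does not increase norms and fixes `u`, so a perturbation of size `r` leaves a
symmetric part of norm at least `(1 + r) - r = 1`; hence the center `(1 + r) u`. The norm stays
below `1 + 2r ≤ 3`. -/
theorem ball_subset_symmShell {u : EuclideanSpace ℝ (ι × ι)} (hu : ∀ a b, u (a, b) = u (b, a))
    (hu1 : ‖u‖ = 1) {r : ℝ} (hr : 0 ≤ r) (hr1 : r ≤ 1) :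
    Metric.ball ((1 + r) • u) r ⊆ symmShell ι := by
  intro v hv
  rw [mem_ball_iff_norm] at hv
  have h1 : ‖(1 + r) • u‖ = 1 + r := by
    rw [norm_smul, hu1, mul_one, Real.norm_of_nonneg (by positivity)]
  refine ⟨?_, ?_⟩
  · rw [mem_ball_zero_iff]
    have := norm_sub_norm_le v ((1 + r) • u)
    linarith
  · have h2 : pairSymm v = (1 + r) • u + pairSymm (v - (1 + r) • u) := by
      rw [← pairSymm_of_symm (v := (1 + r) • u) (fun a b => by simp [hu a b]), ← pairSymm_add,
        pairSymm_of_symm (v := (1 + r) • u) (fun a b => by simp [hu a b])]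
      congr 1; abel
    have h3 := norm_pairSymm_le (v - (1 + r) • u)
    have h4 := norm_sub_le (pairSymm v) (pairSymm (v - (1 + r) • u))
    rw [Set.mem_ofPred_eq]
    have h5 : pairSymm v - pairSymm (v - (1 + r) • u) = (1 + r) • u := by
      rw [h2]; abel
    rw [h5] at h4
    linarith

theorem measurable_blockSum_uncurry {Ω : Type*} [MeasurableSpace Ω]
    {D V : EuclideanSpace ℝ ι →L[ℝ] EuclideanSpace ℝ ι} {W : ℕ → Ω → EuclideanSpace ℝ ι}
    (hW : ∀ k, Measurable (W k)) (H : EuclideanSpace ℝ (ι × ι))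
    (j m : ℕ) : Measurable fun p : Ω × EuclideanSpace ℝ (ι × ι) =>
      ENNReal.ofReal (Real.exp (-(4 / j * blockSum j m fun k =>
        truncSq (fun z => ⟪p.2, pairFeature H z⟫) (linState D V W k p.1)))) := by
  have hYm := measurable_linState D V hW
  refine ((Measurable.const_mul (Finset.measurable_sum _ fun i _ => ?_) _).neg.exp).ennreal_ofReal
  unfold truncSq
  have h1 : Measurable fun p : Ω × EuclideanSpace ℝ (ι × ι) =>
      linState D V W (i.1 + (i.2 + 1) * j) p.1 := (hYm _).comp measurable_fst
  refine Measurable.ite (measurableSet_le (h1.norm.pow_const 2) measurable_const) ?_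
    measurable_const
  exact (measurable_snd.inner ((continuous_pairFeature H).measurable.comp h1)).pow_const 2

end Feature

section Uniform

variable {Ω : Type*} [MeasurableSpace Ω] {μ : Measure Ω} [IsProbabilityMeasure μ]
  {ι : Type*} [Fintype ι] [Nonempty ι]
  {D V : EuclideanSpace ℝ ι →L[ℝ] EuclideanSpace ℝ ι} {W : ℕ → Ω → EuclideanSpace ℝ ι}

theorem lintegral_exp_blockSum_le (hW : ∀ k, Measurable (W k)) (hind : iIndepFun W μ)
    (hlaw : ∀ k, μ.map (W k) = stdGaussian (EuclideanSpace ℝ ι))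
    (hDV : ∀ t, ‖ContinuousLinearMap.adjoint D t‖ ^ 2 + ‖ContinuousLinearMap.adjoint V t‖ ^ 2 =
      ‖t‖ ^ 2) {j : ℕ} (hj0 : 0 < j) (hj : ‖D ^ j‖ ≤ 1 / 2) (H v : EuclideanSpace ℝ (ι × ι))
    (hv : 1 ≤ ‖pairSymm v‖) (m : ℕ) :
    ∫⁻ ω, ENNReal.ofReal (Real.exp (-(4 / j * blockSum j m fun k =>
        truncSq (fun z => ⟪v, pairFeature H z⟫) (linState D V W k ω)))) ∂μ ≤
      ENNReal.ofReal (2 * (1 - 1 / 8192) ^ m) := by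
  have hj' : (0 : ℝ) < j := by exact_mod_cast hj0
  have hv2 : 1 ≤ ∑ a, ∑ b, pairSymm v (a, b) ^ 2 := by
    have h := one_le_pow₀ hv (n := 2)
    rwa [EuclideanSpace.real_norm_sq_eq, Fintype.sum_prod_type] at h
  have hchain := fun r => lintegral_chain_le (W := W) hW hind hlaw hDV hj
    (fun a b => pairSymm v (a, b)) (fun a b => by simp only [pairSymm_apply]; ring) hv2 ⟪v, H⟫ r m
  simp only [truncSq_pairFeature] at hchain
  have hYm := measurable_linState D V hW
  have htm : Measurable (truncSq fun z => ⟪v, pairFeature H z⟫) :=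
    measurable_truncSq (continuous_const.inner (continuous_pairFeature H)).measurable
  calc _ ≤ ∫⁻ ω, ∑ r ∈ Finset.range j, ENNReal.ofReal (1 / (j : ℝ)) *
        ENNReal.ofReal (lyapunovWeight (linState D V W (r + m * j) ω) *
          Real.exp (-(4 * ∑ i ∈ Finset.range m,
          truncSq (fun z => ⟪v, pairFeature H z⟫) (linState D V W (r + (i + 1) * j) ω)))) ∂μ := by
        refine lintegral_mono fun ω => ?_
        refine (ENNReal.ofReal_le_ofReal (exp_blockSum_le hj0 m _)).trans ?_
        rw [ENNReal.ofReal_sum_of_nonneg fun _ _ => by positivity]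
        refine Finset.sum_le_sum fun r _ => ?_
        rw [← ENNReal.ofReal_mul (by positivity)]
        refine ENNReal.ofReal_le_ofReal (mul_le_mul_of_nonneg_left ?_ (by positivity))
        exact le_mul_of_one_le_left (Real.exp_pos _).le (one_le_lyapunovWeight _)
    _ = ∑ r ∈ Finset.range j, ENNReal.ofReal (1 / (j : ℝ)) * ∫⁻ ω,
        ENNReal.ofReal (lyapunovWeight (linState D V W (r + m * j) ω) *
          Real.exp (-(4 * ∑ i ∈ Finset.range m,
          truncSq (fun z => ⟪v, pairFeature H z⟫) (linState D V W (r + (i + 1) * j) ω)))) ∂μ := by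
        rw [lintegral_finsetSum']
        · exact Finset.sum_congr rfl fun r _ =>
            lintegral_const_mul' _ _ ENNReal.ofReal_ne_top
        · intro r _
          refine (Measurable.const_mul (Measurable.ennreal_ofReal ?_) _).aemeasurable
          exact (continuous_lyapunovWeight.measurable.comp (hYm _)).mul
            ((Finset.measurable_sum _ fun i _ => htm.comp (hYm _)).const_mul 4).neg.exp
    _ ≤ ∑ r ∈ Finset.range j, ENNReal.ofReal (1 / (j : ℝ)) *
        ENNReal.ofReal (2 * (1 - 1 / 8192) ^ m) :=
        Finset.sum_le_sum fun r _ => mul_le_mul_right (hchain r) _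
    _ = _ := by
        rw [Finset.sum_const, Finset.card_range, nsmul_eq_mul, ← mul_assoc,
          ← ENNReal.ofReal_natCast, ← ENNReal.ofReal_mul hj'.le, mul_one_div_cancel hj'.ne',
          ENNReal.ofReal_one, one_mul]

/-- Uniform lower bound for the truncated energy of the chain, in logarithmic form. -/
theorem blockSum_lower_bound (hW : ∀ k, Measurable (W k)) (hind : iIndepFun W μ)
    (hlaw : ∀ k, μ.map (W k) = stdGaussian (EuclideanSpace ℝ ι))
    (hDV : ∀ t, ‖ContinuousLinearMap.adjoint D t‖ ^ 2 + ‖ContinuousLinearMap.adjoint V t‖ ^ 2 =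
      ‖t‖ ^ 2) {j : ℕ} (hj0 : 0 < j) (hj : ‖D ^ j‖ ≤ 1 / 2) (H : EuclideanSpace ℝ (ι × ι))
    (m : ℕ) {δ : ℝ} (hδ : 0 < δ) :
    ENNReal.ofReal (1 - δ) ≤ μ {ω | ∫⁻ v in symmShell ι,
      ENNReal.ofReal (Real.exp (-(4 / j * blockSum j m fun k =>
        truncSq (fun z => ⟪v, pairFeature H z⟫) (linState D V W k ω)))) <
      volume (Metric.ball (0 : EuclideanSpace ℝ (ι × ι)) 3) *
        ENNReal.ofReal (2 * (1 - 1 / 8192) ^ m / δ)} := by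
  set J : Ω → ENNReal := fun ω => ∫⁻ v in symmShell ι,
      ENNReal.ofReal (Real.exp (-(4 / j * blockSum j m fun k =>
        truncSq (fun z => ⟪v, pairFeature H z⟫) (linState D V W k ω))))
  set B := volume (Metric.ball (0 : EuclideanSpace ℝ (ι × ι)) 3) *
        ENNReal.ofReal (2 * (1 - 1 / 8192) ^ m / δ) with hB
  have hmeas := measurable_blockSum_uncurry (D := D) (V := V) hW H j m
  have hJm : Measurable J := hmeas.lintegral_prod_right'
  have hpos : (0 : ℝ) < 2 * (1 - 1 / 8192) ^ m / δ := by positivity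
  have hvol0 : volume (Metric.ball (0 : EuclideanSpace ℝ (ι × ι)) 3) ≠ 0 :=
    (Metric.measure_ball_pos _ _ (by norm_num)).ne'
  have hvolT : volume (Metric.ball (0 : EuclideanSpace ℝ (ι × ι)) 3) ≠ ⊤ :=
    measure_ball_lt_top.ne
  have hB0 : B ≠ 0 := mul_ne_zero hvol0 (by simpa using hpos)
  have hBT : B ≠ ⊤ := ENNReal.mul_ne_top hvolT ENNReal.ofReal_ne_top
  -- Tonelli reduces to a fixed direction of the shell, whose volume is at most that of the ball of
  -- radius `3`. Markov's inequality then costs the factor `1/δ` in `B`.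
  have hint : ∫⁻ ω, J ω ∂μ ≤ ENNReal.ofReal δ * B := by
    calc _ = ∫⁻ v in symmShell ι, ∫⁻ ω, ENNReal.ofReal (Real.exp (-(4 / j * blockSum j m fun k =>
          truncSq (fun z => ⟪v, pairFeature H z⟫) (linState D V W k ω)))) ∂μ :=
          lintegral_lintegral_swap hmeas.aemeasurable
      _ ≤ ∫⁻ _v in symmShell ι, ENNReal.ofReal (2 * (1 - 1 / 8192) ^ m) :=
          setLIntegral_mono' measurableSet_symmShell fun v hv =>
            lintegral_exp_blockSum_le hW hind hlaw hDV hj0 hj H v hv.2 m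
      _ ≤ ENNReal.ofReal δ * B := by
          rw [setLIntegral_const, hB, mul_left_comm, ← ENNReal.ofReal_mul hδ.le,
            mul_div_cancel₀ _ hδ.ne', mul_comm]
          gcongr
          exact Set.inter_subset_left
  have hM : μ {ω | B ≤ J ω} ≤ ENNReal.ofReal δ := by
    refine (meas_ge_le_lintegral_div hJm.aemeasurable hB0 hBT).trans ?_
    exact ENNReal.div_le_of_le_mul hint
  have hset : {ω | J ω < B} = {ω | B ≤ J ω}ᶜ := by ext ω; simp
  rw [hset, prob_compl_eq_one_sub (measurableSet_le measurable_const hJm),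
    ENNReal.ofReal_sub _ hδ.le, ENNReal.ofReal_one]
  exact tsub_le_tsub_left hM _

/-- On the event of `blockSum_lower_bound`, the energy is large in every symmetric direction. -/
theorem le_blockSum_of_lintegral_lt {y : ℕ → EuclideanSpace ℝ ι} {j : ℕ} (hj0 : 0 < j)
    (H : EuclideanSpace ℝ (ι × ι)) (m : ℕ) {δ : ℝ} (hδ : 0 < δ)
    (hy : ∫⁻ v in symmShell ι, ENNReal.ofReal (Real.exp (-(4 / j * blockSum j m fun k =>
        truncSq (fun z => ⟪v, pairFeature H z⟫) (y k)))) <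
      volume (Metric.ball (0 : EuclideanSpace ℝ (ι × ι)) 3) *
        ENNReal.ofReal (2 * (1 - 1 / 8192) ^ m / δ))
    {u : EuclideanSpace ℝ (ι × ι)} (hu : ∀ a b, u (a, b) = u (b, a)) (hu1 : ‖u‖ = 1) {r : ℝ}
    (hr : 0 < r) (hr1 : r ≤ 1) :
    1 / 8192 * m - (Fintype.card ι) ^ 2 * Real.log (3 / r) - Real.log (2 / δ) -
        4 * m * r ^ 2 * (2 * 384 ^ 2 + 2 * ‖H‖ ^ 2 / (Fintype.card ι) ^ 2) ≤
      16 / j * blockSum j m fun k => ⟪u, pairFeature H (y k)⟫ ^ 2 := by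
  have hn : (0 : ℝ) < Fintype.card ι := by exact_mod_cast Fintype.card_pos
  have hj' : (0 : ℝ) < j := by exact_mod_cast hj0
  set n : ℝ := ((Fintype.card ι : ℕ) : ℝ)
  have hfin : (Module.finrank ℝ (EuclideanSpace ℝ (ι × ι)) : ℝ) = n ^ 2 := by
    simp [n, sq]
  set s := Finset.range j ×ˢ Finset.range m with hs
  set τ : ℕ × ℕ → ℕ := fun p => p.1 + (p.2 + 1) * j
  -- Truncation enters as a weight independent of `v`, so the exponent is a quadratic form in `v`
  -- and Jensen on a ball applies.
  set a : ℕ × ℕ → ℝ := fun p => if ‖y (τ p)‖ ^ 2 ≤ 384 * n then 4 / (j : ℝ) else 0 with ha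
  set φ : ℕ × ℕ → EuclideanSpace ℝ (ι × ι) := fun p => pairFeature H (y (τ p)) with hφ
  have ha0 : ∀ p, 0 ≤ a p := fun p => by simp only [ha]; split_ifs <;> positivity
  have haj : ∀ p, a p ≤ 4 / j := fun p => by
    simp only [ha]; split_ifs
    · exact le_rfl
    · positivity
  have hQ : ∀ v, 4 / j * (blockSum j m fun k =>
      truncSq (fun z => ⟪v, pairFeature H z⟫) (y k)) = ∑ p ∈ s, a p * ⟪v, φ p⟫ ^ 2 := by
    intro v
    rw [blockSum, Finset.mul_sum]
    refine Finset.sum_congr rfl fun p _ => ?_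
    simp only [ha, truncSq, hφ, τ, n]
    split_ifs <;> simp
  simp_rw [hQ] at hy
  set u' := (1 + r) • u
  have hcont : Continuous fun v => Real.exp (-∑ p ∈ s, a p * ⟪v, φ p⟫ ^ 2) := by fun_prop
  set X := ∑ p ∈ s, a p * (⟪u', φ p⟫ ^ 2 + r ^ 2 * ‖φ p‖ ^ 2 / n ^ 2) with hX
  have h1 := le_setIntegral_ball_exp s a (fun p _ => ha0 p) φ u' hr
  rw [hfin, setIntegral_ball_translate (fun v => Real.exp (-∑ p ∈ s, a p * ⟪v, φ p⟫ ^ 2))] at h1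
  -- The ball of radius `r` about `(1 + r) u` lies in the shell: its integral is bounded below by
  -- Jensen and above by the event `hy`.
  have h2 : ENNReal.ofReal (volume.real (Metric.ball (0 : EuclideanSpace ℝ (ι × ι)) r) *
      Real.exp (-X)) < volume (Metric.ball (0 : EuclideanSpace ℝ (ι × ι)) 3) *
        ENNReal.ofReal (2 * (1 - 1 / 8192) ^ m / δ) := by
    refine ((ENNReal.ofReal_le_ofReal h1).trans ?_).trans_lt hy
    rw [ofReal_integral_eq_lintegral_ofReal (integrableOn_ball_of_continuous hcont _ _)
      (.of_forall fun _ => (Real.exp_pos _).le)]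
    exact lintegral_mono_set (ball_subset_symmShell hu hu1 hr.le hr1)
  have hvr : ∀ R : ℝ, 0 < R → volume.real (Metric.ball (0 : EuclideanSpace ℝ (ι × ι)) R) =
      R ^ (Fintype.card (ι × ι)) *
        volume.real (Metric.ball (0 : EuclideanSpace ℝ (ι × ι)) 1) := by
    intro R hR
    rw [measureReal_def, Measure.addHaar_ball_of_pos _ _ hR, ENNReal.toReal_mul,
      ENNReal.toReal_ofReal (by positivity), finrank_euclideanSpace]
    rfl
  have hv1 : 0 < volume.real (Metric.ball (0 : EuclideanSpace ℝ (ι × ι)) 1) :=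
    ENNReal.toReal_pos (Metric.measure_ball_pos _ _ one_pos).ne' measure_ball_lt_top.ne
  have hpos : (0 : ℝ) < 2 * (1 - 1 / 8192) ^ m / δ := by positivity
  rw [← ofReal_measureReal (measure_ball_lt_top.ne), ← ENNReal.ofReal_mul measureReal_nonneg,
    ENNReal.ofReal_lt_ofReal_iff (by rw [hvr 3 (by norm_num)]; positivity), hvr r hr,
    hvr 3 (by norm_num)] at h2
  -- Volumes scale like the power `n²` of the radius; the ratio of the two balls is the entropy cost
  -- `n² log(3/r)`.
  have h3 : r ^ (Fintype.card (ι × ι)) * Real.exp (-X) <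
      3 ^ (Fintype.card (ι × ι)) * (2 * (1 - 1 / 8192) ^ m / δ) := by
    refine lt_of_mul_lt_mul_left (a := volume.real (Metric.ball (0 : EuclideanSpace ℝ (ι × ι)) 1))
      ?_ hv1.le
    linarith
  have h4 := Real.log_lt_log (by positivity) h3
  rw [Real.log_mul (by positivity) (by positivity), Real.log_mul (by positivity) hpos.ne',
    Real.log_exp, Real.log_pow, Real.log_pow, mul_div_right_comm,
    Real.log_mul (by positivity) (by positivity), Real.log_pow] at h4
  have hcard : (Fintype.card (ι × ι) : ℝ) = n ^ 2 := by simp [n, sq]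
  have hlq : Real.log (1 - 1 / 8192) ≤ -(1 / 8192) := by
    have := Real.log_le_sub_one_of_pos (show (0 : ℝ) < 1 - 1 / 8192 by norm_num)
    linarith
  have hlr : Real.log (3 / r) = Real.log 3 - Real.log r := Real.log_div (by norm_num) hr.ne'
  rw [hcard] at h4
  have h5 : (m : ℝ) * Real.log (1 - 1 / 8192) ≤ m * (-(1 / 8192)) := by gcongr
  have h6 : 1 / 8192 * m - n ^ 2 * Real.log (3 / r) - Real.log (2 / δ) ≤ X := by
    rw [hlr]; linarith
  -- The factor `(1 + r)² ≤ 4` turns `4/j` into `16/j`. Where the weight is nonzero, `‖φ‖² ≤ 2(384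
  -- n)² + 2‖H‖²`, and the division by `n²` comes from averaging over the ball.
  have h7 : X ≤ (16 / j * blockSum j m fun k => ⟪u, pairFeature H (y k)⟫ ^ 2) +
      4 * m * r ^ 2 * (2 * 384 ^ 2 + 2 * ‖H‖ ^ 2 / n ^ 2) := by
    have hterm : ∀ p ∈ s, a p * (⟪u', φ p⟫ ^ 2 + r ^ 2 * ‖φ p‖ ^ 2 / n ^ 2) ≤
        16 / j * ⟪u, φ p⟫ ^ 2 + 4 / j * (r ^ 2 * (2 * 384 ^ 2 + 2 * ‖H‖ ^ 2 / n ^ 2)) := by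
      intro p _
      rw [mul_add]
      refine add_le_add ?_ ?_
      · calc a p * ⟪u', φ p⟫ ^ 2 ≤ 4 / j * (4 * ⟪u, φ p⟫ ^ 2) := by
              refine mul_le_mul (haj p) ?_ (sq_nonneg _) (by positivity)
              rw [inner_smul_left, conj_trivial, mul_pow]
              gcongr
              nlinarith
          _ = _ := by ring
      · by_cases hc : ‖y (τ p)‖ ^ 2 ≤ 384 * n
        · refine mul_le_mul (haj p) ?_ (by positivity) (by positivity)
          rw [mul_div_assoc]
          gcongr
          rw [div_le_iff₀ (by positivity), add_mul, div_mul_cancel₀ _ (by positivity)]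
          refine (norm_pairFeature_sq_le H _).trans ?_
          have hc2 : (‖y (τ p)‖ ^ 2) ^ 2 ≤ (384 * n) ^ 2 := by gcongr
          linarith
        · have : a p = 0 := if_neg hc
          rw [this, zero_mul]; positivity
    refine (Finset.sum_le_sum hterm).trans (le_of_eq ?_)
    rw [Finset.sum_add_distrib, ← Finset.mul_sum, Finset.sum_const, hs, Finset.card_product,
      Finset.card_range, Finset.card_range, nsmul_eq_mul, blockSum]
    push_cast
    congr 1
    field_simp
  linarith

end Uniform
end

/-! ### Powers of a matrix: resolvent bounds, Cayley–Hamilton and the block length -/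

noncomputable section

section Resolvent

open Filter Topology

variable {𝔸 : Type*} [NormedRing 𝔸] [NormedAlgebra ℂ 𝔸] [CompleteSpace 𝔸]

/-- Gelfand's formula; the strict gap `s < r` is what makes the powers of `r⁻¹ a` tend to zero. -/
theorem eventually_norm_pow_le_of_spectralRadius_lt {a : 𝔸} {r : ℝ}
    (h : spectralRadius ℂ a < ENNReal.ofReal r) :
    ∃ s : ℝ, 0 ≤ s ∧ s < r ∧ ∀ᶠ k : ℕ in atTop, ‖a ^ k‖ ≤ s ^ k := by
  obtain ⟨s, hs1, hs2⟩ := ENNReal.lt_iff_exists_nnreal_btwn.mp h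
  refine ⟨s, s.2, ?_, ?_⟩
  · by_contra hc
    exact absurd (ENNReal.ofReal_le_ofReal (not_lt.mp hc)) (by simpa using hs2)
  have hg := (spectrum.pow_nnnorm_pow_one_div_tendsto_nhds_spectralRadius a).eventually_lt_const hs1
  filter_upwards [hg, eventually_gt_atTop 0] with k hk hk0
  have hk0' : (0 : ℝ) < k := by exact_mod_cast hk0
  have h1 : (‖a ^ k‖₊ : ENNReal) ≤ (s : ENNReal) ^ k := by
    calc (‖a ^ k‖₊ : ENNReal) = ((‖a ^ k‖₊ : ENNReal) ^ (1 / k : ℝ)) ^ k := by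
          rw [← ENNReal.rpow_natCast, ← ENNReal.rpow_mul, one_div_mul_cancel hk0'.ne',
            ENNReal.rpow_one]
      _ ≤ (s : ENNReal) ^ k := by gcongr
  exact_mod_cast h1

theorem tendsto_inv_smul_pow_of_spectralRadius_lt {a : 𝔸} {r : ℝ} (hr : 0 < r)
    (h : spectralRadius ℂ a < ENNReal.ofReal r) :
    Tendsto (fun k => (((r⁻¹ : ℝ) : ℂ) • a) ^ k) atTop (𝓝 0) := by
  obtain ⟨s, hs0, hsr, hs⟩ := eventually_norm_pow_le_of_spectralRadius_lt h
  have h1 : Tendsto (fun k : ℕ => (r⁻¹ * s) ^ k) atTop (𝓝 0) :=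
    tendsto_pow_atTop_nhds_zero_of_lt_one (by positivity) (by rw [inv_mul_lt_one₀ hr]; exact hsr)
  refine squeeze_zero_norm' ?_ h1
  filter_upwards [hs] with k hk
  rw [smul_pow, norm_smul, mul_pow, norm_pow, Complex.norm_real,
    Real.norm_of_nonneg (by positivity)]
  gcongr

theorem tendsto_pow_of_spectralRadius_lt_one {a : 𝔸} (h : spectralRadius ℂ a < 1) :
    Tendsto (fun k => a ^ k) atTop (𝓝 0) := by
  have := tendsto_inv_smul_pow_of_spectralRadius_lt (a := a) one_pos (by simpa using h)
  simpa using this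

/-- If `z` were in the spectrum, `z ^ k` would be a spectral value of `a ^ k` of modulus one,
keeping `‖a ^ k‖ ≥ 1`. -/
theorem mem_resolventSet_of_tendsto_pow [NormOneClass 𝔸] {a : 𝔸}
    (ha : Tendsto (fun k => a ^ k) atTop (𝓝 0)) {z : ℂ} (hz : ‖z‖ = 1) :
    z ∈ resolventSet ℂ a := by
  by_contra hc
  have hz' : z ∈ spectrum ℂ a := hc
  have h1 : ∀ k : ℕ, 1 ≤ ‖a ^ k‖ := fun k => by
    have := spectrum.norm_le_norm_of_mem (spectrum.pow_mem_pow a k hz')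
    rwa [norm_pow, hz, one_pow] at this
  have h2 := ge_of_tendsto' ha.norm h1
  rw [norm_zero] at h2
  linarith

theorem sum_rootsOfUnity_pow {K : ℕ} {ζ : ℂ} (hζ : IsPrimitiveRoot ζ K) (e : ℕ) :
    ∑ l ∈ Finset.range K, ζ ^ (l * e) = if K ∣ e then (K : ℂ) else 0 := by
  simp_rw [mul_comm _ e, pow_mul]
  split_ifs with h
  · rw [(hζ.pow_eq_one_iff_dvd e).mpr h]; simp
  · have h1 : ζ ^ e ≠ 1 := fun hc => h ((hζ.pow_eq_one_iff_dvd e).mp hc)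
    rw [geom_sum_eq h1, ← pow_mul, mul_comm, pow_mul, hζ.pow_eq_one]
    simp

/-- Powers are bounded by the supremum of the resolvent on the unit circle. -/
theorem norm_pow_le_of_resolvent_le [NormOneClass 𝔸] {a : 𝔸}
    (ha : Tendsto (fun k => a ^ k) atTop (𝓝 0)) {R : ℝ}
    (hR : ∀ z : ℂ, ‖z‖ = 1 → ‖resolvent a z‖ ≤ R) (j : ℕ) : ‖a ^ j‖ ≤ R := by
  -- A discrete Cauchy formula: `a ^ j` is the average of `z^(j+1) (1 - a^K) (z - a)⁻¹` over the
  -- `K`-th roots of unity, because `(z - a) ∑ z^i a^(K-1-i) = z^K - a^K`. Letting `K → ∞` removes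
  -- the factor `1 - a^K`.
  have key : ∀ K : ℕ, j < K → ‖a ^ j‖ ≤ ‖1 - a ^ K‖ * R := by
    intro K hK
    have hK0 : K ≠ 0 := by omega
    have hKpos : (0 : ℝ) < K := by exact_mod_cast Nat.pos_of_ne_zero hK0
    obtain ⟨ζ, hζ⟩ : ∃ ζ : ℂ, IsPrimitiveRoot ζ K := ⟨_, Complex.isPrimitiveRoot_exp K hK0⟩
    have hnorm : ‖ζ‖ = 1 := hζ.norm'_eq_one hK0
    have hres : ∀ z : ℂ, ‖z‖ = 1 → z ^ K = 1 →
        ∑ i ∈ Finset.range K, z ^ i • a ^ (K - 1 - i) = (1 - a ^ K) * resolvent a z := by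
      intro z hz hzK
      have hu : IsUnit (algebraMap ℂ 𝔸 z - a) := mem_resolventSet_of_tendsto_pow ha hz
      have hcomm : Commute (algebraMap ℂ 𝔸 z) a := Algebra.commutes z a
      have h := hcomm.geom_sum₂_mul K
      rw [← map_pow, hzK, map_one] at h
      rw [← h, resolvent, mul_assoc, Ring.mul_inverse_cancel _ hu, mul_one]
      refine Finset.sum_congr rfl fun i _ => ?_
      rw [← map_pow, Algebra.smul_def]
    have hsum : ∑ l ∈ Finset.range K, ζ ^ (l * (j + 1)) • ((1 - a ^ K) * resolvent a (ζ ^ l)) =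
        (K : ℂ) • a ^ j := by
      calc _ = ∑ l ∈ Finset.range K, ∑ i ∈ Finset.range K,
            ζ ^ (l * (j + 1 + i)) • a ^ (K - 1 - i) := by
            refine Finset.sum_congr rfl fun l _ => ?_
            rw [← hres (ζ ^ l) (by rw [norm_pow, hnorm, one_pow])
              (by rw [← pow_mul, mul_comm, pow_mul, hζ.pow_eq_one, one_pow]), Finset.smul_sum]
            refine Finset.sum_congr rfl fun i _ => ?_
            rw [smul_smul, ← pow_mul, ← pow_add, mul_add l (j + 1) i]
        _ = ∑ i ∈ Finset.range K, (if K ∣ j + 1 + i then (K : ℂ) else 0) • a ^ (K - 1 - i) := by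
            rw [Finset.sum_comm]
            refine Finset.sum_congr rfl fun i _ => ?_
            rw [← Finset.sum_smul, sum_rootsOfUnity_pow hζ]
        _ = (K : ℂ) • a ^ j := by
            -- As `0 < j + 1 + i < 2K`, the only multiple of `K` occurs at `j + 1 + i = K`.
            rw [Finset.sum_eq_single (K - 1 - j)]
            · rw [if_pos (by rw [show j + 1 + (K - 1 - j) = K by omega]),
                show K - 1 - (K - 1 - j) = j by omega]
            · intro i hi hne
              rw [if_neg, zero_smul]
              rintro ⟨c, hc⟩
              have hi' := Finset.mem_range.mp hi
              have hc1 : c < 2 := by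
                by_contra hcc
                have := Nat.mul_le_mul_left K (not_lt.mp hcc)
                omega
              interval_cases c <;> omega
            · intro hi
              exact absurd (Finset.mem_range.mpr (by omega)) hi
    have h1 : ‖(K : ℂ) • a ^ j‖ ≤ ∑ _l ∈ Finset.range K, ‖1 - a ^ K‖ * R := by
      rw [← hsum]
      refine norm_sum_le_of_le _ fun l _ => ?_
      rw [norm_smul, norm_pow, hnorm, one_pow, one_mul]
      refine (norm_mul_le _ _).trans ?_
      gcongr
      exact hR _ (by rw [norm_pow, hnorm, one_pow])
    rw [norm_smul, Complex.norm_natCast, Finset.sum_const, Finset.card_range, nsmul_eq_mul] at h1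
    exact le_of_mul_le_mul_left h1 hKpos
  have hlim : Tendsto (fun K : ℕ => ‖1 - a ^ K‖ * R) atTop (𝓝 (‖(1 : 𝔸) - 0‖ * R)) :=
    (tendsto_const_nhds.sub ha).norm.mul_const R
  rw [sub_zero, norm_one, one_mul] at hlim
  exact ge_of_tendsto hlim ((eventually_gt_atTop j).mono fun K hK => key K hK)

theorem bddAbove_norm_resolvent [NormOneClass 𝔸] {a : 𝔸}
    (ha : Tendsto (fun k => a ^ k) atTop (𝓝 0)) :
    BddAbove (Set.range fun z : Metric.sphere (0 : ℂ) 1 => ‖resolvent a (z : ℂ)‖) := by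
  have hc : Continuous fun z : Metric.sphere (0 : ℂ) 1 => ‖resolvent a (z : ℂ)‖ := by
    refine Continuous.norm (continuous_iff_continuousAt.mpr fun z => ?_)
    have hz : (z : ℂ) ∈ resolventSet ℂ a :=
      mem_resolventSet_of_tendsto_pow ha (mem_sphere_zero_iff_norm.mp z.2)
    exact (spectrum.hasDerivAt_resolvent_const_left hz).continuousAt.comp
      continuous_subtype_val.continuousAt
  exact (isCompact_range hc).bddAbove

end Resolvent

section Matrix

open scoped Matrix.Norms.L2Operator
open Filter Topology

variable {n : ℕ}

theorem toComplexMatrix_pow (M : Matrix (Fin n) (Fin n) ℝ) (k : ℕ) :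
    toComplexMatrix (M ^ k) = toComplexMatrix M ^ k :=
  map_pow ((algebraMap ℝ ℂ).mapMatrix (m := Fin n)) M k

theorem toComplexMatrix_mul (M N : Matrix (Fin n) (Fin n) ℝ) :
    toComplexMatrix (M * N) = toComplexMatrix M * toComplexMatrix N :=
  map_mul ((algebraMap ℝ ℂ).mapMatrix (m := Fin n)) M N

theorem toComplexMatrix_smul (c : ℝ) (M : Matrix (Fin n) (Fin n) ℝ) :
    toComplexMatrix (c • M) = (c : ℂ) • toComplexMatrix M := by
  ext i j; simp [toComplexMatrix]

theorem norm_le_norm_toComplexMatrix (M : Matrix (Fin n) (Fin n) ℝ) :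
    ‖M‖ ≤ ‖toComplexMatrix M‖ := by
  rw [Matrix.cstar_norm_def]
  refine ContinuousLinearMap.opNorm_le_bound _ (norm_nonneg _) fun x => ?_
  set z : EuclideanSpace ℂ (Fin n) := WithLp.toLp 2 fun i => (x i : ℂ)
  have hz : ‖z‖ = ‖x‖ := by simp [z, EuclideanSpace.norm_eq]
  have h := Matrix.l2_opNorm_mulVec (toComplexMatrix M) z
  have e : ‖(WithLp.toLp 2 ((toComplexMatrix M) *ᵥ z.ofLp) : EuclideanSpace ℂ (Fin n))‖ =
      ‖Matrix.toEuclideanCLM (n := Fin n) (𝕜 := ℝ) M x‖ := by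
    rw [EuclideanSpace.norm_eq, EuclideanSpace.norm_eq]
    congr 1
    refine Finset.sum_congr rfl fun i _ => ?_
    congr 1
    rw [← Complex.norm_real]
    congr 1
    simp [toComplexMatrix, Matrix.mulVec, dotProduct, z]
  rw [← hz, ← e]
  exact h

theorem hinfNorm_eq (M : Matrix (Fin n) (Fin n) ℝ) :
    hinfNorm (resolventFun M) =
      ⨆ z : Metric.sphere (0 : ℂ) 1, ‖resolvent (toComplexMatrix M) (z : ℂ)‖ := rfl

/-- The powers of `L` are controlled by the `H∞` norm of the resolvent of `ρ⁻¹ L`. -/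
theorem norm_pow_le_hinfNorm [NeZero n] {L : Matrix (Fin n) (Fin n) ℝ} {ρ : ℝ} (hρ : 0 < ρ)
    (h : spectralRadius ℂ (toComplexMatrix L) < ENNReal.ofReal ρ) (j : ℕ) :
    ‖L ^ j‖ ≤ hinfNorm (resolventFun (ρ⁻¹ • L)) * ρ ^ j := by
  have ht : Tendsto (fun k => toComplexMatrix (ρ⁻¹ • L) ^ k) atTop (𝓝 0) := by
    rw [toComplexMatrix_smul]
    exact tendsto_inv_smul_pow_of_spectralRadius_lt hρ h
  have h1 : ‖toComplexMatrix (ρ⁻¹ • L) ^ j‖ ≤ hinfNorm (resolventFun (ρ⁻¹ • L)) := by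
    refine norm_pow_le_of_resolvent_le ht (fun z hz => ?_) j
    rw [hinfNorm_eq]
    exact le_ciSup (bddAbove_norm_resolvent ht) ⟨z, mem_sphere_zero_iff_norm.mpr hz⟩
  rw [← toComplexMatrix_pow] at h1
  have h2 := (norm_le_norm_toComplexMatrix _).trans h1
  rw [smul_pow, norm_smul, norm_pow, norm_inv, Real.norm_of_nonneg hρ.le, inv_pow,
    inv_mul_le_iff₀ (by positivity)] at h2
  linarith

theorem one_le_hinfNorm [NeZero n] {L : Matrix (Fin n) (Fin n) ℝ} {ρ : ℝ} (hρ : 0 < ρ)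
    (h : spectralRadius ℂ (toComplexMatrix L) < ENNReal.ofReal ρ) :
    1 ≤ hinfNorm (resolventFun (ρ⁻¹ • L)) := by
  simpa using norm_pow_le_hinfNorm hρ h 0

theorem norm_le_of_mem_spectrum_toComplexMatrix {L : Matrix (Fin n) (Fin n) ℝ} {ρ : ℝ} (hρ : 0 < ρ)
    (h : spectralRadius ℂ (toComplexMatrix L) < ENNReal.ofReal ρ) {z : ℂ}
    (hz : z ∈ spectrum ℂ (toComplexMatrix L)) : ‖z‖ ≤ ρ := by
  by_contra hc
  refine hz (spectrum.mem_resolventSet_of_spectralRadius_lt (h.trans ?_))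
  rw [ENNReal.ofReal, ENNReal.coe_lt_coe, Real.toNNReal_lt_iff_lt_coe hρ.le]
  exact not_le.mp hc

/-- A contraction whose eigenvalues lie in the disk of radius `ρ` has small powers of
order `m n`, by the Cayley–Hamilton theorem applied to its `m`-th power. -/
theorem norm_pow_mul_le_of_spectrum [NeZero n] {T : Matrix (Fin n) (Fin n) ℝ} (hT : ‖T‖ ≤ 1) {ρ : ℝ}
    (hspec : ∀ z ∈ spectrum ℂ (toComplexMatrix T), ‖z‖ ≤ ρ) {m : ℕ} (hm : 0 < m) :
    ‖T ^ (m * n)‖ ≤ (1 + ρ ^ m) ^ n - 1 := by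
  set S := T ^ m
  have hS : ‖S‖ ≤ 1 := (norm_pow_le _ _).trans (pow_le_one₀ (norm_nonneg _) hT)
  set p := S.charpoly
  have hdeg : p.natDegree = n := by simp [p, Matrix.charpoly_natDegree_eq_dim]
  have hmonic : p.Monic := S.charpoly_monic
  have hmap : p.map (algebraMap ℝ ℂ) = (toComplexMatrix S).charpoly :=
    (Matrix.charpoly_map S (algebraMap ℝ ℂ)).symm
  -- The coefficients are, up to sign, elementary symmetric functions of the eigenvalues of `T ^ m`,
  -- all of modulus at most `ρ ^ m`.
  have hcoeff : ∀ i, |p.coeff i| ≤ (ρ ^ m) ^ (n - i) * n.choose i := by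
    intro i
    have h := Polynomial.coeff_le_of_roots_le (f := algebraMap ℝ ℂ) (B := ρ ^ m) i hmonic
      (IsAlgClosed.splits _) (fun z hz => ?_)
    · rwa [Polynomial.coeff_map, hdeg, Complex.coe_algebraMap, Complex.norm_real,
        Real.norm_eq_abs] at h
    · rw [hmap] at hz
      have hz2 : z ∈ spectrum ℂ (toComplexMatrix S) :=
        Matrix.mem_spectrum_of_isRoot_charpoly (Polynomial.isRoot_of_mem_roots hz)
      rw [toComplexMatrix_pow, spectrum.map_pow_of_pos _ hm] at hz2
      obtain ⟨w, hw, rfl⟩ := hz2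
      simp only [norm_pow]
      gcongr
      exact hspec w hw
  have hCH := Matrix.aeval_self_charpoly S
  rw [Polynomial.aeval_eq_sum_range, hdeg, Finset.sum_range_succ] at hCH
  have hlead : p.coeff n = 1 := by
    have := hmonic.coeff_natDegree; rwa [hdeg] at this
  rw [hlead, one_smul] at hCH
  have hSn : S ^ n = -∑ i ∈ Finset.range n, p.coeff i • S ^ i := by
    rw [eq_neg_iff_add_eq_zero, add_comm]; exact hCH
  rw [pow_mul, hSn, norm_neg]
  have hbin : (1 + ρ ^ m) ^ n - 1 = ∑ i ∈ Finset.range n, (ρ ^ m) ^ (n - i) * n.choose i := by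
    rw [add_pow, Finset.sum_range_succ]
    simp
  rw [hbin]
  refine norm_sum_le_of_le _ fun i _ => ?_
  rw [norm_smul, Real.norm_eq_abs]
  have h1 : ‖S ^ i‖ ≤ 1 := (norm_pow_le _ _).trans (pow_le_one₀ (norm_nonneg _) hS)
  calc |p.coeff i| * ‖S ^ i‖ ≤ |p.coeff i| * 1 := by gcongr
    _ ≤ _ := by rw [mul_one]; exact hcoeff i

end Matrix

/-- Block length: a contraction with eigenvalues in the disk of radius `ρ` and powers bounded by
`Γ ρ ^ j` has a power of norm at most one half, of controlled order. -/
theorem exists_block_length {n : ℕ} (hn : 1 ≤ n) {f : ℕ → ℝ} {ρ Γ : ℝ} (hρ : 0 < ρ) (hρ1 : ρ < 1)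
    (hΓ : 1 ≤ Γ) (hf1 : ∀ j, f j ≤ Γ * ρ ^ j)
    (hf2 : ∀ m : ℕ, 0 < m → f (m * n) ≤ (1 + ρ ^ m) ^ n - 1) :
    ∃ j : ℕ, 0 < j ∧ f j ≤ 1 / 2 ∧ j * (1 - ρ) ≤ Real.log (2 * Γ) + 1 ∧
      j * (1 - ρ) ≤ 4 * (n : ℝ) ^ 2 := by
  have hn' : (1 : ℝ) ≤ n := by exact_mod_cast hn
  have hρ0 : 0 < 1 - ρ := by linarith
  have hexp : ∀ j : ℕ, ∀ t : ℝ, 0 < t → Real.log t / (1 - ρ) ≤ j → ρ ^ j ≤ 1 / t := by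
    intro j t ht hj
    rw [div_le_iff₀ hρ0] at hj
    have h1 : ρ ≤ Real.exp (-(1 - ρ)) := by
      have := Real.add_one_le_exp (-(1 - ρ)); linarith
    calc ρ ^ j ≤ Real.exp (-(1 - ρ)) ^ j := by gcongr
      _ = Real.exp (-(j * (1 - ρ))) := by rw [← Real.exp_nat_mul]; ring_nf
      _ ≤ Real.exp (-Real.log t) := Real.exp_le_exp.mpr (by linarith)
      _ = 1 / t := by rw [Real.exp_neg, Real.exp_log ht, one_div]
  have hlog1 : 0 < Real.log (2 * Γ) := Real.log_pos (by linarith)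
  have hlog2 : 0 < Real.log (4 * n) := Real.log_pos (by linarith)
  -- `j₁` makes `Γ ρ^j₁ ≤ 1/2`; `m` makes `n ρ^m ≤ 1/4`, so that `(1 + ρ^m)^n - 1 ≤ e^(1/4) - 1 ≤
  -- 1/2`. The smaller of `j₁` and `m n` inherits both length bounds.
  set j₁ := ⌈Real.log (2 * Γ) / (1 - ρ)⌉₊
  set m := ⌈Real.log (4 * n) / (1 - ρ)⌉₊
  have hj1 : 0 < j₁ := Nat.ceil_pos.mpr (by positivity)
  have hm : 0 < m := Nat.ceil_pos.mpr (by positivity)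
  have hfj1 : f j₁ ≤ 1 / 2 := by
    have h := hexp j₁ (2 * Γ) (by linarith) (Nat.le_ceil _)
    calc f j₁ ≤ Γ * ρ ^ j₁ := hf1 _
      _ ≤ Γ * (1 / (2 * Γ)) := by gcongr
      _ = 1 / 2 := by field_simp
  have hfj2 : f (m * n) ≤ 1 / 2 := by
    have h := hexp m (4 * n) (by linarith) (Nat.le_ceil _)
    have h2 : (1 + ρ ^ m) ^ n ≤ Real.exp (1 / 4) := by
      calc (1 + ρ ^ m) ^ n ≤ Real.exp (ρ ^ m) ^ n := by
            gcongr
            have := Real.add_one_le_exp (ρ ^ m); linarith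
        _ = Real.exp (n * ρ ^ m) := by rw [← Real.exp_nat_mul]
        _ ≤ Real.exp (1 / 4) := by
            refine Real.exp_le_exp.mpr ?_
            calc n * ρ ^ m ≤ n * (1 / (4 * n)) := by gcongr
              _ = 1 / 4 := by field_simp
    have h3 : Real.exp (1 / 4) ≤ 3 / 2 := by
      have := Real.exp_bound_div_one_sub_of_interval (x := 1 / 4) (by norm_num) (by norm_num)
      norm_num at this ⊢
      linarith
    linarith [hf2 m hm]
  have hb1 : j₁ * (1 - ρ) ≤ Real.log (2 * Γ) + 1 := by
    have h := (Nat.ceil_lt_add_one (a := Real.log (2 * Γ) / (1 - ρ)) (by positivity)).le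
    calc (j₁ : ℝ) * (1 - ρ) ≤ (Real.log (2 * Γ) / (1 - ρ) + 1) * (1 - ρ) := by gcongr
      _ = Real.log (2 * Γ) + (1 - ρ) := by field_simp
      _ ≤ _ := by linarith
  have hb2 : ((m * n : ℕ) : ℝ) * (1 - ρ) ≤ 4 * (n : ℝ) ^ 2 := by
    have h := (Nat.ceil_lt_add_one (a := Real.log (4 * n) / (1 - ρ)) (by positivity)).le
    have hl := Real.log_le_sub_one_of_pos (show (0 : ℝ) < 4 * n by linarith)
    have hmb : (m : ℝ) * (1 - ρ) ≤ 4 * n := by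
      calc (m : ℝ) * (1 - ρ) ≤ (Real.log (4 * n) / (1 - ρ) + 1) * (1 - ρ) := by gcongr
        _ = Real.log (4 * n) + (1 - ρ) := by field_simp
        _ ≤ _ := by linarith
    push_cast
    nlinarith
  rcases le_total j₁ (m * n) with h | h
  · refine ⟨j₁, hj1, hfj1, hb1, le_trans ?_ hb2⟩
    gcongr
  · refine ⟨m * n, by positivity, hfj2, le_trans ?_ hb1, hb2⟩
    gcongr
end

/-! ### Smallest eigenvalues, Frobenius norms and the Lyapunov equation -/

noncomputable section

section LambdaMin

open scoped Matrix.Norms.L2Operator MatrixOrder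

variable {ι : Type*} [Fintype ι] [DecidableEq ι]

theorem le_lambdaMin [Nonempty ι] {G : Matrix ι ι ℝ} (hG : G.IsHermitian) {b : ℝ}
    (h : ∀ x : ι → ℝ, b * (x ⬝ᵥ x) ≤ x ⬝ᵥ G *ᵥ x) : b ≤ lambdaMin G := by
  rw [lambdaMin_eq_iInf_eigenvalues hG]
  refine le_ciInf fun i => ?_
  have h1 := h (hG.eigenvectorBasis i)
  have h2 : (hG.eigenvectorBasis i : ι → ℝ) ⬝ᵥ (hG.eigenvectorBasis i : ι → ℝ) = 1 := by
    have := EuclideanSpace.real_norm_sq_eq (hG.eigenvectorBasis i)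
    rw [(hG.eigenvectorBasis).orthonormal.1 i, one_pow] at this
    rw [this, dotProduct]
    exact Finset.sum_congr rfl fun j _ => (sq _).symm
  rw [hG.mulVec_eigenvectorBasis, dotProduct_smul, h2] at h1
  simpa using h1

theorem lambdaMin_mul_le {P : Matrix ι ι ℝ} (hP : P.IsHermitian) (x : ι → ℝ) :
    lambdaMin P * (x ⬝ᵥ x) ≤ x ⬝ᵥ P *ᵥ x := by
  have h : algebraMap ℝ (Matrix ι ι ℝ) (lambdaMin P) ≤ P :=
    algebraMap_le_of_le_spectrum (fun y hy => csInf_le P.finite_real_spectrum.bddBelow hy) hP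
  have h2 := (Matrix.le_iff.mp h).dotProduct_mulVec_nonneg x
  rw [Matrix.sub_mulVec, dotProduct_sub, Algebra.algebraMap_eq_smul_one, Matrix.smul_mulVec,
    Matrix.one_mulVec, dotProduct_smul, smul_eq_mul, star_trivial] at h2
  linarith

theorem card_mul_lambdaMin_le_trace {P : Matrix ι ι ℝ} (hP : P.IsHermitian) :
    Fintype.card ι * lambdaMin P ≤ P.trace := by
  rw [Matrix.trace, ← nsmul_eq_mul, ← Finset.card_univ, ← Finset.sum_const]
  refine Finset.sum_le_sum fun i _ => ?_
  have := lambdaMin_mul_le hP (Pi.single i 1)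
  simpa using this

/-- A matrix that dominates the identity factors as `S Sᵀ` with `S` invertible. -/
theorem exists_factorization {P : Matrix ι ι ℝ} (hP : P.IsHermitian)
    (h : ∀ x : ι → ℝ, x ⬝ᵥ x ≤ x ⬝ᵥ P *ᵥ x) :
    ∃ S : Matrix ι ι ℝ, S * Sᵀ = P ∧ IsUnit S.det := by
  have hps : P.PosSemidef := .of_dotProduct_mulVec_nonneg hP fun x => by
    rw [star_trivial]
    refine le_trans ?_ (h x)
    exact Finset.sum_nonneg fun i _ => mul_self_nonneg _
  obtain ⟨B, hB⟩ := CStarAlgebra.nonneg_iff_eq_star_mul_self.mp hps.nonneg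
  have hB' : Bᵀ * B = P := hB.symm
  refine ⟨Bᵀ, by rw [Matrix.transpose_transpose, hB'], ?_⟩
  rw [Matrix.det_transpose, isUnit_iff_ne_zero]
  intro hdet
  obtain ⟨v, hv, hBv⟩ := Matrix.exists_mulVec_eq_zero_iff.mpr hdet
  have h1 := h v
  rw [← hB', ← Matrix.mulVec_mulVec, hBv, Matrix.mulVec_zero, dotProduct_zero] at h1
  exact hv (dotProduct_self_eq_zero.mp (le_antisymm h1
    (Finset.sum_nonneg fun i _ => mul_self_nonneg _)))

end LambdaMin

section Frobenius

variable {ι κ : Type*} [Fintype ι] [Fintype κ]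

/-- The squared Frobenius norm. -/
def frobSq (M : Matrix ι κ ℝ) : ℝ := ∑ a, ∑ b, M a b ^ 2

theorem frobSq_eq_trace (M : Matrix ι κ ℝ) : frobSq M = (Mᵀ * M).trace := by
  simp only [frobSq, Matrix.trace, Matrix.diag, Matrix.mul_apply, Matrix.transpose_apply]
  rw [Finset.sum_comm]
  exact Finset.sum_congr rfl fun a _ => Finset.sum_congr rfl fun b _ => sq _

theorem frobSq_transpose (M : Matrix ι κ ℝ) : frobSq Mᵀ = frobSq M := Finset.sum_comm

theorem frobSq_nonneg (M : Matrix ι κ ℝ) : 0 ≤ frobSq M :=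
  Finset.sum_nonneg fun _ _ => Finset.sum_nonneg fun _ _ => sq_nonneg _

theorem frobSq_mul_transpose_comm (R : Matrix ι ι ℝ) : frobSq (R * Rᵀ) = frobSq (Rᵀ * R) := by
  rw [frobSq_eq_trace, frobSq_eq_trace]
  simp only [Matrix.transpose_mul, Matrix.transpose_transpose]
  rw [Matrix.mul_assoc, Matrix.trace_mul_comm]
  simp only [Matrix.mul_assoc]

theorem mul_frobSq_le_frobSq_mul {S : Matrix ι ι ℝ} {c : ℝ}
    (hS : ∀ v : ι → ℝ, c * (v ⬝ᵥ v) ≤ (S *ᵥ v) ⬝ᵥ (S *ᵥ v)) (M : Matrix ι κ ℝ) :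
    c * frobSq M ≤ frobSq (S * M) := by
  rw [← frobSq_transpose M, ← frobSq_transpose (S * M), frobSq, frobSq, Finset.mul_sum]
  refine Finset.sum_le_sum fun b _ => ?_
  have h := hS fun a => M a b
  simp only [dotProduct, ← sq] at h
  exact h

/-- The columnwise bound is used twice, for the left factor directly and for the right factor after
transposing; each use gains `c`. -/
theorem sq_mul_frobSq_le {S : Matrix ι ι ℝ} {c : ℝ} (hc : 0 ≤ c)
    (hS : ∀ v : ι → ℝ, c * (v ⬝ᵥ v) ≤ (Sᵀ *ᵥ v) ⬝ᵥ (Sᵀ *ᵥ v)) (M : Matrix ι ι ℝ) :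
    c ^ 2 * frobSq M ≤ frobSq (Sᵀ * M * S) := by
  have h1 := mul_frobSq_le_frobSq_mul hS (M * S)
  have h2 := mul_frobSq_le_frobSq_mul hS Mᵀ
  have h3 : frobSq (Sᵀ * Mᵀ) = frobSq (M * S) := by
    rw [← Matrix.transpose_mul, frobSq_transpose]
  rw [h3, frobSq_transpose] at h2
  rw [Matrix.mul_assoc]
  nlinarith [mul_le_mul_of_nonneg_left h2 hc]

/-- Apply `sq_mul_frobSq_le` to `M = S⁻ᵀS⁻¹`, for which `SᵀMS = 1`. This controls the whitened
offset and is the source of the `η² n / λ_min²` requirement. -/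
theorem frobSq_inv_mul_transpose_le [DecidableEq ι] {S : Matrix ι ι ℝ} {c : ℝ} (hc : 0 ≤ c)
    (hS : ∀ v : ι → ℝ, c * (v ⬝ᵥ v) ≤ (Sᵀ *ᵥ v) ⬝ᵥ (Sᵀ *ᵥ v)) (hdet : IsUnit S.det) :
    c ^ 2 * frobSq (S⁻¹ * S⁻¹ᵀ) ≤ Fintype.card ι := by
  have hS1 : S⁻¹ * S = 1 := Matrix.nonsing_inv_mul S hdet
  have h := sq_mul_frobSq_le hc hS (S⁻¹ᵀ * S⁻¹)
  have e : Sᵀ * (S⁻¹ᵀ * S⁻¹) * S = 1 := by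
    rw [Matrix.mul_assoc, Matrix.mul_assoc, hS1, Matrix.mul_one, ← Matrix.transpose_mul, hS1,
      Matrix.transpose_one]
  rw [e, ← frobSq_mul_transpose_comm] at h
  have h1 : frobSq (1 : Matrix ι ι ℝ) = Fintype.card ι := by
    rw [frobSq_eq_trace]; simp
  rwa [h1] at h

end Frobenius

section Lyapunov

open scoped Matrix.Norms.L2Operator
open Filter Topology

variable {n : ℕ}

theorem tendsto_pow_of_spectralRadius_toComplexMatrix_lt {L : Matrix (Fin n) (Fin n) ℝ}
    (hL : spectralRadius ℂ (toComplexMatrix L) < 1) : Tendsto (fun k => L ^ k) atTop (𝓝 0) := by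
  have h := (tendsto_pow_of_spectralRadius_lt_one hL).norm
  rw [norm_zero] at h
  refine squeeze_zero_norm (fun k => ?_) h
  rw [← toComplexMatrix_pow]
  exact norm_le_norm_toComplexMatrix _

/-- The general `Q` covers the equation itself (`Q = 1`) and its homogeneous version (`Q = 0`). -/
theorem dotProduct_mulVec_lyapunov {L P Q : Matrix (Fin n) (Fin n) ℝ}
    (hP : L * P * Lᵀ + Q = P) (x y : Fin n → ℝ) :
    x ⬝ᵥ P *ᵥ y = (Lᵀ *ᵥ x) ⬝ᵥ P *ᵥ (Lᵀ *ᵥ y) + x ⬝ᵥ Q *ᵥ y := by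
  conv_lhs => rw [← hP]
  rw [Matrix.add_mulVec, dotProduct_add, ← Matrix.mulVec_mulVec, ← Matrix.mulVec_mulVec,
    Matrix.dotProduct_mulVec x L, Matrix.mulVec_transpose L x]

theorem tendsto_transpose_pow_dotProduct {L : Matrix (Fin n) (Fin n) ℝ}
    (hL : Tendsto (fun k => L ^ k) atTop (𝓝 0)) (P : Matrix (Fin n) (Fin n) ℝ) (x y : Fin n → ℝ) :
    Tendsto (fun k : ℕ => ((Lᵀ ^ k) *ᵥ x) ⬝ᵥ P *ᵥ ((Lᵀ ^ k) *ᵥ y)) atTop (𝓝 0) := by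
  have hc : Continuous fun M : Matrix (Fin n) (Fin n) ℝ => (Mᵀ *ᵥ x) ⬝ᵥ P *ᵥ (Mᵀ *ᵥ y) := by
    fun_prop
  have := (hc.tendsto 0).comp hL
  simpa [Function.comp_def, Matrix.transpose_pow] using this

/-- `Pᵀ - P` solves the homogeneous equation, so its bilinear form is unchanged when both arguments
are moved by powers of `Lᵀ`, which tend to zero. -/
theorem isSymm_of_lyapunov {L P : Matrix (Fin n) (Fin n) ℝ}
    (hL : Tendsto (fun k => L ^ k) atTop (𝓝 0)) (hP : L * P * Lᵀ - P + 1 = 0) : P.IsSymm := by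
  have hP' : L * P * Lᵀ + 1 = P := by
    rw [← sub_eq_zero, ← hP]; abel
  have hPt : L * Pᵀ * Lᵀ + 1 = Pᵀ := by
    conv_rhs => rw [← hP']
    simp [Matrix.transpose_mul, Matrix.mul_assoc]
  have hQ : L * (Pᵀ - P) * Lᵀ + 0 = Pᵀ - P := by
    have h1 := congrArg₂ (· - ·) hPt hP'
    simp only [add_sub_add_right_eq_sub] at h1
    rw [add_zero, Matrix.mul_sub, Matrix.sub_mul, h1]
  have hzero : ∀ x y, x ⬝ᵥ (Pᵀ - P) *ᵥ y = 0 := by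
    intro x y
    have hk : ∀ k : ℕ, ((Lᵀ ^ k) *ᵥ x) ⬝ᵥ (Pᵀ - P) *ᵥ ((Lᵀ ^ k) *ᵥ y) = x ⬝ᵥ (Pᵀ - P) *ᵥ y := by
      intro k
      induction k with
      | zero => simp
      | succ k ih =>
        rw [← ih, dotProduct_mulVec_lyapunov hQ (Lᵀ ^ k *ᵥ x), pow_succ', ← Matrix.mulVec_mulVec x,
          ← Matrix.mulVec_mulVec y]
        simp
    have := tendsto_transpose_pow_dotProduct hL (Pᵀ - P) x y
    simp_rw [hk] at this
    exact tendsto_nhds_unique tendsto_const_nhds this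
  rw [Matrix.IsSymm, ← sub_eq_zero]
  ext i j
  have := hzero (Pi.single i 1) (Pi.single j 1)
  simpa using this

/-- `P` is the sum of `L^k (Lᵀ)^k`, whose term `k = 0` is the identity. Iterating the equation and
passing to the limit avoids the series. -/
theorem dotProduct_self_le_of_lyapunov {L P : Matrix (Fin n) (Fin n) ℝ}
    (hL : Tendsto (fun k => L ^ k) atTop (𝓝 0)) (hP : L * P * Lᵀ - P + 1 = 0) (x : Fin n → ℝ) :
    x ⬝ᵥ x ≤ x ⬝ᵥ P *ᵥ x := by
  have hP' : L * P * Lᵀ + 1 = P := by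
    rw [← sub_eq_zero, ← hP]; abel
  have hstep : ∀ y : Fin n → ℝ, y ⬝ᵥ P *ᵥ y = (Lᵀ *ᵥ y) ⬝ᵥ P *ᵥ (Lᵀ *ᵥ y) + y ⬝ᵥ y := fun y => by
    simpa using dotProduct_mulVec_lyapunov hP' y y
  have hk : ∀ k : ℕ, ((Lᵀ ^ (k + 1)) *ᵥ x) ⬝ᵥ P *ᵥ ((Lᵀ ^ (k + 1)) *ᵥ x) + x ⬝ᵥ x ≤
      x ⬝ᵥ P *ᵥ x := by
    intro k
    induction k with
    | zero => rw [hstep x]; simp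
    | succ k ih =>
      refine le_trans ?_ ih
      rw [hstep (Lᵀ ^ (k + 1) *ᵥ x), pow_succ' _ (k + 1), ← Matrix.mulVec_mulVec x]
      have : 0 ≤ (Lᵀ ^ (k + 1) *ᵥ x) ⬝ᵥ (Lᵀ ^ (k + 1) *ᵥ x) :=
        Finset.sum_nonneg fun i _ => mul_self_nonneg _
      linarith
  have ht := ((tendsto_transpose_pow_dotProduct hL P x x).comp (tendsto_add_atTop_nat 1)).add_const
    (x ⬝ᵥ x)
  rw [zero_add] at ht
  exact le_of_tendsto' ht hk

end Lyapunov
end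

/-! ### Whitening the chain -/

noncomputable section

section Whitening

open scoped Matrix.Norms.L2Operator InnerProductSpace

variable {n : ℕ}

/-- The operator on Euclidean space given by a real matrix. -/
abbrev euclideanCLM (M : Matrix (Fin n) (Fin n) ℝ) :
    EuclideanSpace ℝ (Fin n) →L[ℝ] EuclideanSpace ℝ (Fin n) :=
  Matrix.toEuclideanCLM (n := Fin n) (𝕜 := ℝ) M

theorem norm_toEuclideanCLM (M : Matrix (Fin n) (Fin n) ℝ) :
    ‖euclideanCLM M‖ = ‖M‖ := rfl

theorem norm_sq_adjoint_add {T R : Matrix (Fin n) (Fin n) ℝ} (h : T * Tᵀ + R * Rᵀ = 1)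
    (t : EuclideanSpace ℝ (Fin n)) :
    ‖ContinuousLinearMap.adjoint (euclideanCLM T) t‖ ^ 2 +
      ‖ContinuousLinearMap.adjoint (euclideanCLM R) t‖ ^ 2 =
      ‖t‖ ^ 2 := by
  have key : ∀ D : EuclideanSpace ℝ (Fin n) →L[ℝ] EuclideanSpace ℝ (Fin n),
      ‖ContinuousLinearMap.adjoint D t‖ ^ 2 = ⟪(D * star D) t, t⟫_ℝ := fun D => by
    rw [← real_inner_self_eq_norm_sq, ContinuousLinearMap.adjoint_inner_right]
    rfl
  rw [key, key, ← inner_add_left, ← _root_.add_apply, ← map_star, ← map_star,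
    ← map_mul, ← map_mul, ← map_add]
  have h' : T * star T + R * star R = 1 := h
  rw [h', map_one, _root_.one_apply_eq_self, real_inner_self_eq_norm_sq]

/-- With the summands exchanged it serves for `S⁻¹` as well as for the whitened matrix. -/
theorem norm_le_one_of_mul_transpose_add {T R : Matrix (Fin n) (Fin n) ℝ}
    (h : T * Tᵀ + R * Rᵀ = 1) : ‖T‖ ≤ 1 := by
  rw [← norm_toEuclideanCLM, ← LinearIsometryEquiv.norm_map ContinuousLinearMap.adjoint]
  exact norm_adjoint_le_one (norm_sq_adjoint_add h)

theorem l2_opNorm_sq_le_trace (S : Matrix (Fin n) (Fin n) ℝ) : ‖S‖ ^ 2 ≤ (S * Sᵀ).trace := by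
  have h0 : (S * Sᵀ).trace = frobSq S := by
    rw [← frobSq_transpose, frobSq_eq_trace, Matrix.transpose_transpose]
  rw [h0]
  rw [← Real.le_sqrt (norm_nonneg _) (frobSq_nonneg _), ← norm_toEuclideanCLM]
  refine ContinuousLinearMap.opNorm_le_bound _ (Real.sqrt_nonneg _) fun x => ?_
  rw [← Real.sqrt_sq (norm_nonneg x), ← Real.sqrt_mul (frobSq_nonneg _)]
  refine Real.le_sqrt_of_sq_le ?_
  rw [EuclideanSpace.real_norm_sq_eq, EuclideanSpace.real_norm_sq_eq, frobSq, Finset.sum_mul]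
  refine Finset.sum_le_sum fun a _ => ?_
  rw [Matrix.ofLp_toEuclideanCLM]
  exact Finset.sum_mul_sq_le_sq_mul_sq Finset.univ (S a) x.ofLp

variable {L P S : Matrix (Fin n) (Fin n) ℝ}

/-- This is the Lyapunov equation conjugated by `S⁻¹`: in the new coordinates the stationary
covariance is the identity. -/
theorem whiten_mul_transpose_add (hP : L * P * Lᵀ - P + 1 = 0) (hS : S * Sᵀ = P)
    (hdet : IsUnit S.det) :
    (S⁻¹ * L * S) * (S⁻¹ * L * S)ᵀ + S⁻¹ * S⁻¹ᵀ = 1 := by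
  have hS1 : S⁻¹ * S = 1 := Matrix.nonsing_inv_mul S hdet
  have hP' : L * P * Lᵀ + 1 = P := by
    rw [← sub_eq_zero, ← hP]; abel
  have e : (S⁻¹ * L * S) * (S⁻¹ * L * S)ᵀ = S⁻¹ * (L * P * Lᵀ) * S⁻¹ᵀ := by
    rw [← hS]
    simp only [Matrix.transpose_mul, Matrix.mul_assoc]
  have e2 : S⁻¹ * S⁻¹ᵀ = S⁻¹ * 1 * S⁻¹ᵀ := by rw [Matrix.mul_one]
  rw [e, e2, ← Matrix.add_mul, ← Matrix.mul_add, hP', ← hS, ← Matrix.mul_assoc, hS1,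
    Matrix.one_mul, ← Matrix.transpose_mul, hS1, Matrix.transpose_one]

theorem whiten_pow (hdet : IsUnit S.det) (j : ℕ) : (S⁻¹ * L * S) ^ j = S⁻¹ * L ^ j * S := by
  have hS1 : S⁻¹ * S = 1 := Matrix.nonsing_inv_mul S hdet
  have hS2 : S * S⁻¹ = 1 := Matrix.mul_nonsing_inv S hdet
  induction j with
  | zero => simp [hS1]
  | succ j ih =>
    rw [pow_succ, ih, pow_succ]
    simp only [Matrix.mul_assoc]
    rw [← Matrix.mul_assoc S S⁻¹, hS2, Matrix.one_mul]

theorem spectrum_whiten (hdet : IsUnit S.det) :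
    spectrum ℂ (toComplexMatrix (S⁻¹ * L * S)) = spectrum ℂ (toComplexMatrix L) := by
  have h1 : toComplexMatrix S⁻¹ * toComplexMatrix S = 1 := by
    rw [← toComplexMatrix_mul, Matrix.nonsing_inv_mul S hdet]; simp [toComplexMatrix]
  have h2 : toComplexMatrix S * toComplexMatrix S⁻¹ = 1 := by
    rw [← toComplexMatrix_mul, Matrix.mul_nonsing_inv S hdet]; simp [toComplexMatrix]
  rw [toComplexMatrix_mul, toComplexMatrix_mul]
  exact spectrum.units_conjugate' (u := ⟨toComplexMatrix S, toComplexMatrix S⁻¹, h2, h1⟩)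

end Whitening

section State

variable {Ω : Type*} {n m : ℕ}

theorem lqrState_eq_linState {A : Matrix (Fin n) (Fin n) ℝ} {B : Matrix (Fin n) (Fin m) ℝ}
    {K : Matrix (Fin m) (Fin n) ℝ} {S : Matrix (Fin n) (Fin n) ℝ} (hdet : IsUnit S.det)
    (W : ℕ → Ω → EuclideanSpace ℝ (Fin n)) (k : ℕ) (ω : Ω) :
    lqrState A B K W k ω = euclideanCLM S
      (linState (euclideanCLM (S⁻¹ * (A + B * K) * S))
        (euclideanCLM S⁻¹) W k ω) := by
  induction k with
  | zero => simp [lqrState, linState]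
  | succ k ih =>
    have hS2 : S * S⁻¹ = 1 := Matrix.mul_nonsing_inv S hdet
    rw [lqrState, linState, map_add, ih]
    congr 1
    · rw [← _root_.mul_apply_eq_comp, ← map_mul, ← Matrix.mul_assoc, ← Matrix.mul_assoc, hS2,
        Matrix.one_mul, map_mul, _root_.mul_apply_eq_comp]
      refine WithLp.ofLp_injective 2 ?_
      rw [Matrix.ofLp_toEuclideanCLM (A + B * K), Matrix.add_mulVec, ← Matrix.mulVec_mulVec]
    · rw [← _root_.mul_apply_eq_comp, ← map_mul, hS2, map_one,
        _root_.one_apply_eq_self]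

end State
end

/-! ### Uniform energy bound and its transfer to the Gram matrix -/

noncomputable section

section Energy

open scoped RealInnerProductSpace

variable {ι : Type*} [Fintype ι] [Nonempty ι] {Ω : Type*} [MeasurableSpace Ω] {μ : Measure Ω}
  [IsProbabilityMeasure μ]

/-- With high probability, the energy of the chain in every symmetric direction is large. -/
theorem prob_blockSum_lower_bound {W : ℕ → Ω → EuclideanSpace ℝ ι}
    {D V : EuclideanSpace ℝ ι →L[ℝ] EuclideanSpace ℝ ι} (hind : iIndepFun W μ)
    (hlaw : ∀ k, HasLaw (W k) (stdGaussian (EuclideanSpace ℝ ι)) μ)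
    (hDV : ∀ t, ‖ContinuousLinearMap.adjoint D t‖ ^ 2 + ‖ContinuousLinearMap.adjoint V t‖ ^ 2 =
      ‖t‖ ^ 2) {j : ℕ} (hj0 : 0 < j) (hj : ‖D ^ j‖ ≤ 1 / 2) (H : EuclideanSpace ℝ (ι × ι))
    (m : ℕ) {δ : ℝ} (hδ : 0 < δ) :
    ENNReal.ofReal (1 - δ) ≤ μ {ω | ∀ u : EuclideanSpace ℝ (ι × ι), (∀ a b, u (a, b) = u (b, a)) →
      ‖u‖ = 1 → ∀ r : ℝ, 0 < r → r ≤ 1 →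
      1 / 8192 * m - (Fintype.card ι) ^ 2 * Real.log (3 / r) - Real.log (2 / δ) -
        4 * m * r ^ 2 * (2 * 384 ^ 2 + 2 * ‖H‖ ^ 2 / (Fintype.card ι) ^ 2) ≤
      16 / j * blockSum j m fun k => ⟪u, pairFeature H (linState D V W k ω)⟫ ^ 2} := by
  -- `HasLaw` gives only almost everywhere measurability, so measurable versions are used; the
  -- trajectories agree almost surely. The target event quantifies over uncountably many `u`; it is
  -- only shown to contain the measurable event above up to a null set.
  set W' : ℕ → Ω → EuclideanSpace ℝ ι := fun k => (hlaw k).aemeasurable.mk (W k)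
  have hae : ∀ k, W k =ᵐ[μ] W' k := fun k => (hlaw k).aemeasurable.ae_eq_mk
  have hW' : ∀ k, Measurable (W' k) := fun k => (hlaw k).aemeasurable.measurable_mk
  have hind' : iIndepFun W' μ := hind.congr hae
  have hlaw' : ∀ k, μ.map (W' k) = stdGaussian (EuclideanSpace ℝ ι) := fun k => by
    rw [← Measure.map_congr (hae k), (hlaw k).map_eq]
  refine (blockSum_lower_bound hW' hind' hlaw' hDV hj0 hj H m hδ).trans ?_
  refine measure_mono_ae ?_
  filter_upwards [ae_all_iff.mpr hae] with ω hω hy u hu hu1 r hr hr1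
  have hst : ∀ k, linState D V W' k ω = linState D V W k ω := by
    intro k
    induction k with
    | zero => rfl
    | succ k ih => rw [linState, linState, ih, hω k]
  have h := le_blockSum_of_lintegral_lt hj0 H m hδ hy hu hu1 hr hr1
  simp_rw [hst] at h
  exact h

end Energy

section Features

open scoped RealInnerProductSpace

variable {n : ℕ}

/-- The vector of all the entries of a matrix. -/
def matVec (M : Matrix (Fin n) (Fin n) ℝ) : EuclideanSpace ℝ (Fin n × Fin n) :=
  WithLp.toLp 2 fun p => M p.1 p.2

theorem norm_matVec_sq (M : Matrix (Fin n) (Fin n) ℝ) : ‖matVec M‖ ^ 2 = frobSq M := by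
  rw [EuclideanSpace.real_norm_sq_eq, Fintype.sum_prod_type]
  rfl

theorem inner_matVec (M M' : Matrix (Fin n) (Fin n) ℝ) :
    ⟪matVec M, matVec M'⟫ = (Mᵀ * M').trace := by
  simp only [PiLp.inner_apply, RCLike.inner_apply, conj_trivial, Fintype.sum_prod_type,
    Matrix.trace, Matrix.diag, Matrix.mul_apply, Matrix.transpose_apply, matVec]
  rw [Finset.sum_comm]
  exact Finset.sum_congr rfl fun a _ => Finset.sum_congr rfl fun b _ => mul_comm _ _

theorem quadForm_matVec (M : Matrix (Fin n) (Fin n) ℝ) (y : EuclideanSpace ℝ (Fin n)) :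
    quadForm (fun a b => matVec M (a, b)) y = y.ofLp ⬝ᵥ M *ᵥ y.ofLp := by
  simp only [quadForm, dotProduct, Matrix.mulVec, Finset.mul_sum, matVec]
  exact Finset.sum_congr rfl fun a _ => Finset.sum_congr rfl fun b _ => by ring

theorem svec_dotProduct_lqrFeature {M : Matrix (Fin n) (Fin n) ℝ} (hM : M.IsSymm) (η : ℝ)
    (x : EuclideanSpace ℝ (Fin n)) :
    svec M ⬝ᵥ lqrFeature η x = x.ofLp ⬝ᵥ M *ᵥ x.ofLp + η * M.trace := by
  have hs : (Matrix.vecMulVec x.ofLp x.ofLp + η • (1 : Matrix (Fin n) (Fin n) ℝ)).IsSymm := by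
    rw [Matrix.IsSymm, Matrix.transpose_add, Matrix.transpose_smul, Matrix.transpose_one,
      Matrix.transpose_vecMulVec]
  rw [lqrFeature, svec_dotProduct_svec hM hs, Matrix.mul_add, Matrix.trace_add, hM.eq,
    Matrix.mul_vecMulVec, Matrix.trace_vecMulVec, Matrix.mul_smul, Matrix.mul_one,
    Matrix.trace_smul, smul_eq_mul, dotProduct_comm]

theorem exists_isSymm_svec_eq (u : UpperIdx n → ℝ) :
    ∃ M : Matrix (Fin n) (Fin n) ℝ, M.IsSymm ∧ svec M = u := by
  refine ⟨Matrix.of fun a b => (if a = b then 1 else (√2)⁻¹) *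
    u ⟨(min a b, max a b), min_le_max⟩, ?_, ?_⟩
  · ext a b
    simp only [Matrix.transpose_apply, Matrix.of_apply, eq_comm (a := b), min_comm b, max_comm b]
  · ext ⟨⟨a, b⟩, hab⟩
    have h2 : √2 ≠ (0 : ℝ) := by positivity
    by_cases h : a = b
    · subst h; simp [svec]
    · simp [svec, h, min_eq_left hab, max_eq_right hab, h2]

/-- The features of the state in the coordinates that whiten its stationary law. -/
theorem svec_dotProduct_lqrFeature_whiten {M S : Matrix (Fin n) (Fin n) ℝ} (hM : M.IsSymm)
    (hdet : IsUnit S.det) (η : ℝ) (y : EuclideanSpace ℝ (Fin n)) :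
    svec M ⬝ᵥ lqrFeature η (euclideanCLM S y) =
      ⟪matVec (Sᵀ * M * S), pairFeature (matVec (η • (S⁻¹ * S⁻¹ᵀ))) y⟫ := by
  have hS2 : S * S⁻¹ = 1 := Matrix.mul_nonsing_inv S hdet
  rw [inner_pairFeature, quadForm_matVec, inner_matVec, svec_dotProduct_lqrFeature hM,
    Matrix.ofLp_toEuclideanCLM]
  congr 1
  · rw [← Matrix.mulVec_mulVec, ← Matrix.mulVec_mulVec, Matrix.dotProduct_mulVec _ Sᵀ,
      Matrix.vecMul_transpose]
  · have e : (Sᵀ * M * S)ᵀ * (S⁻¹ * S⁻¹ᵀ) = Sᵀ * (M * S⁻¹ᵀ) := by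
      simp only [Matrix.transpose_mul, Matrix.transpose_transpose, hM.eq, Matrix.mul_assoc]
      rw [← Matrix.mul_assoc S S⁻¹, hS2, Matrix.one_mul]
    rw [Matrix.mul_smul, Matrix.trace_smul, smul_eq_mul, e, Matrix.trace_mul_comm,
      Matrix.mul_assoc, ← Matrix.transpose_mul, hS2, Matrix.transpose_one, Matrix.mul_one]

theorem dotProduct_featureGram_mulVec {Ω : Type*} (η : ℝ) (X : ℕ → Ω → EuclideanSpace ℝ (Fin n))
    (N : ℕ) (ω : Ω) (u : UpperIdx n → ℝ) :
    u ⬝ᵥ featureGram η X N ω *ᵥ u =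
      ∑ k ∈ Finset.Icc 1 N, (u ⬝ᵥ lqrFeature η (X k ω)) ^ 2 := by
  rw [featureGram, Matrix.sum_mulVec, dotProduct_sum]
  refine Finset.sum_congr rfl fun k _ => ?_
  rw [Matrix.vecMulVec_mulVec, dotProduct_smul, dotProduct_comm _ u]
  simp [sq]

theorem isHermitian_featureGram {Ω : Type*} (η : ℝ) (X : ℕ → Ω → EuclideanSpace ℝ (Fin n))
    (N : ℕ) (ω : Ω) : (featureGram η X N ω).IsHermitian := by
  ext p q
  simp [featureGram, Matrix.sum_apply, Matrix.vecMulVec_apply, mul_comm]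

/-- The times `r + (i + 1) j` run exactly once through `j, …, (m + 1) j - 1`; reducing modulo `j`
gives injectivity. -/
theorem blockSum_le_sum_Icc {j m N : ℕ} (hj : 0 < j) (hN : (m + 1) * j ≤ N) {g : ℕ → ℝ}
    (hg : ∀ k, 0 ≤ g k) : blockSum j m g ≤ ∑ k ∈ Finset.Icc 1 N, g k := by
  rw [blockSum, ← Finset.sum_image (f := g) (g := fun p : ℕ × ℕ => p.1 + (p.2 + 1) * j)]
  · refine Finset.sum_le_sum_of_subset_of_nonneg ?_ fun k _ _ => hg k
    intro k hk
    obtain ⟨⟨r, i⟩, hp, rfl⟩ := Finset.mem_image.mp hk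
    simp only [Finset.mem_product, Finset.mem_range] at hp
    have h1 : (i + 1) * j ≤ m * j := Nat.mul_le_mul_right j hp.2
    have h2 : j ≤ (i + 1) * j := Nat.le_mul_of_pos_left j (Nat.succ_pos i)
    rw [add_mul, one_mul] at hN
    simp only [Finset.mem_Icc]
    omega
  · rintro ⟨r, i⟩ hp ⟨r', i'⟩ hp' h
    simp only [Finset.coe_product, Finset.coe_range, Set.mem_prod, Set.mem_Iio] at hp hp'
    simp only at h
    have h1 := congrArg (· % j) h
    simp only [Nat.add_mul_mod_self_right, Nat.mod_eq_of_lt hp.1, Nat.mod_eq_of_lt hp'.1] at h1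
    subst h1
    have h2 := Nat.eq_of_mul_eq_mul_right hj (Nat.add_left_cancel h)
    simpa using h2

/-- A lower bound on the whitened energy in every direction bounds the Gram matrix below. -/
theorem le_lambdaMin_featureGram [NeZero n] {Ω : Type*} {S : Matrix (Fin n) (Fin n) ℝ}
    (hdet : IsUnit S.det) {lam : ℝ} (hlam : 0 < lam)
    (hS : ∀ v : Fin n → ℝ, lam * (v ⬝ᵥ v) ≤ (Sᵀ *ᵥ v) ⬝ᵥ (Sᵀ *ᵥ v)) (η : ℝ)
    {X Y : ℕ → Ω → EuclideanSpace ℝ (Fin n)} (hX : ∀ k ω, X k ω = euclideanCLM S (Y k ω)) {N : ℕ}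
    {ω : Ω} {b : ℝ} (hb : 0 ≤ b)
    (hE : ∀ u : EuclideanSpace ℝ (Fin n × Fin n), (∀ a b, u (a, b) = u (b, a)) → ‖u‖ = 1 →
      b ≤ ∑ k ∈ Finset.Icc 1 N, ⟪u, pairFeature (matVec (η • (S⁻¹ * S⁻¹ᵀ))) (Y k ω)⟫ ^ 2) :
    b * lam ^ 2 ≤ lambdaMin (featureGram η X N ω) := by
  have : Nonempty (UpperIdx n) := ⟨⟨(0, 0), le_rfl⟩⟩
  refine le_lambdaMin (isHermitian_featureGram η X N ω) fun u => ?_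
  obtain ⟨M, hM, rfl⟩ := exists_isSymm_svec_eq u
  rw [dotProduct_featureGram_mulVec, svec_dotProduct_svec hM hM, ← frobSq_eq_trace]
  set Z := matVec (Sᵀ * M * S) with hZ
  have hZn : lam ^ 2 * frobSq M ≤ ‖Z‖ ^ 2 := by
    rw [norm_matVec_sq]; exact sq_mul_frobSq_le hlam.le hS M
  simp_rw [hX, svec_dotProduct_lqrFeature_whiten hM hdet, ← hZ]
  rcases eq_or_ne Z 0 with h0 | h0
  · rw [h0, norm_zero] at hZn
    have : b * (lam ^ 2 * frobSq M) ≤ b * 0 ^ 2 := mul_le_mul_of_nonneg_left hZn hb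
    rw [mul_assoc]
    exact this.trans (by rw [zero_pow two_ne_zero, mul_zero]; positivity)
  · have hZ0 : 0 < ‖Z‖ := norm_pos_iff.mpr h0
    -- Both sides are homogeneous of degree two in `Z`, so the unit-vector bound scales by `‖Z‖²`,
    -- which is at least `lam²` times the squared length of `svec M`.
    have h1 := hE (‖Z‖⁻¹ • Z) (fun a b => ?_)
      (by rw [norm_smul, norm_inv, norm_norm, inv_mul_cancel₀ hZ0.ne'])
    · simp_rw [real_inner_smul_left, mul_pow, ← Finset.mul_sum] at h1
      rw [inv_pow, ← div_eq_inv_mul, le_div_iff₀ (by positivity)] at h1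
      rw [mul_assoc]
      exact (mul_le_mul_of_nonneg_left hZn hb).trans h1
    · have hs : (Sᵀ * M * S).IsSymm := by
        rw [Matrix.IsSymm]
        simp only [Matrix.transpose_mul, Matrix.transpose_transpose, hM.eq, Matrix.mul_assoc]
      have : Z (a, b) = Z (b, a) := hs.apply b a
      simp [this]

end Features
end

/-! ### Numerical constants -/

noncomputable section

section Numerics

/-- Here `log(2√2) > 1.0397`, and `log y ≥ 1 - 1/y`. The iterated logarithm is used only through
this constant lower bound. -/
theorem log_log_lower_bounds {x : ℝ} (hx : 2 * √2 ≤ x) :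
    1 ≤ Real.log x ∧ 1 / 30 ≤ Real.log (Real.log x) := by
  have h1 : Real.log (2 * √2) ≤ Real.log x := Real.log_le_log (by positivity) hx
  rw [Real.log_mul (by norm_num) (by positivity), Real.log_sqrt (by norm_num)] at h1
  have h2 := Real.log_two_gt_d9
  have hA : 1.0397 ≤ Real.log x := by linarith
  have hB := Real.one_sub_inv_le_log_of_pos (show 0 < Real.log x by linarith)
  have hI : (Real.log x)⁻¹ ≤ (1.0397)⁻¹ := inv_anti₀ (by norm_num) hA
  exact ⟨by linarith, by norm_num at hI ⊢; linarith⟩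

/-- The number of blocks is large compared with the dimension and the confidence. -/
theorem number_of_blocks_bounds {C κ A B ρ N Γ δ j n : ℝ} (hC : 0 ≤ C) (hκ : n ^ 2 ≤ κ)
    (hκ0 : 0 ≤ κ) (hρ1 : ρ < 1) (hδ : 0 < δ) (hδ1 : δ < 1) (hN : 2 ≤ N) (hΓ : √2 ≤ Γ)
    (hA : A = Real.log (Γ * N / δ)) (hB : B = Real.log A)
    (hj : 0 < j) (hj1 : j * (1 - ρ) ≤ Real.log (2 * Γ) + 1) (hj2 : j * (1 - ρ) ≤ 4 * n ^ 2)
    (hcond : C * (κ / (1 - ρ)) ≤ N / (A * B)) :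
    C * κ / 60 ≤ N / j ∧ C * A / 120 ≤ N / j ∧ Real.log (2 / δ) ≤ A := by
  have hρ0 : 0 < 1 - ρ := by linarith
  have hΓ0 : 0 < Γ := lt_of_lt_of_le (by positivity) hΓ
  have hx1 : Γ * N ≤ Γ * N / δ := le_div_self (by positivity) hδ hδ1.le
  have hs : (1 : ℝ) ≤ √2 := Real.one_le_sqrt.mpr (by norm_num)
  have hx2 : 2 * √2 ≤ Γ * N / δ := by nlinarith
  obtain ⟨hA1, hB1⟩ := log_log_lower_bounds hx2
  rw [← hA] at hA1 hB1
  rw [← hB] at hB1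
  have hA2 : Real.log (2 * Γ) ≤ A := by
    rw [hA]; exact Real.log_le_log (by positivity) (by nlinarith)
  have hA3 : Real.log (2 / δ) ≤ A := by
    rw [hA]
    refine Real.log_le_log (by positivity) ?_
    gcongr
    nlinarith
  have hAB : 0 < A * B := by positivity
  rw [le_div_iff₀ hAB, mul_div_assoc', div_mul_eq_mul_div, div_le_iff₀ hρ0] at hcond
  -- The product `κ A` is divided by `j(1 - ρ)`: the bound `log(2Γ) + 1 ≤ 2A` leaves `κ`, and the
  -- bound `4n² ≤ 4κ` leaves `A`.
  have hcond2 : C * κ * A / 30 ≤ N * (1 - ρ) := by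
    refine le_trans ?_ hcond
    have : C * κ * A * (1 / 30) ≤ C * κ * A * B := by gcongr
    linarith
  refine ⟨?_, ?_, hA3⟩
  · rw [le_div_iff₀ hj]
    refine le_of_mul_le_mul_right ?_ hρ0
    have : C * κ / 60 * (j * (1 - ρ)) ≤ C * κ / 60 * (2 * A) :=
      mul_le_mul_of_nonneg_left (by linarith) (by positivity)
    linarith
  · rw [le_div_iff₀ hj]
    refine le_of_mul_le_mul_right ?_ hρ0
    have : C * A / 120 * (j * (1 - ρ)) ≤ C * A / 120 * (4 * κ) :=
      mul_le_mul_of_nonneg_left (by linarith) (by positivity)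
    linarith

theorem energy_numerics {κ A N j m n h s b E : ℝ} (hn : 1 ≤ n) (hκ : n ^ 2 ≤ κ) (hκh : h ≤ κ)
    (hh : 0 ≤ h) (hj : 0 < j) (hM1 : 10 ^ 20 * κ / 60 ≤ N / j) (hM2 : 10 ^ 20 * A / 120 ≤ N / j)
    (hs : s ≤ A) (hm1 : N / j - 2 ≤ m) (hm2 : 0 ≤ m) (hb : b ≤ E)
    (henergy : ∀ r : ℝ, 0 < r → r ≤ 1 → 1 / 8192 * m - n ^ 2 * Real.log (3 / r) - s -
      4 * m * r ^ 2 * (2 * 384 ^ 2 + 2 * h / n ^ 2) ≤ 16 / j * b) :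
    1 / 2 ^ 18 * N ≤ E := by
  have hn2 : 1 ≤ n ^ 2 := one_le_pow₀ hn
  have hd : 0 < 1 + h / n ^ 2 := by positivity
  -- `t` is the squared radius. It makes the averaging error at most `8·384²/10¹¹ · m`, well below
  -- `m/8192`, while the entropy is at most a constant times `n² (1 + h/n²) = n² + h ≤ 2κ`.
  set t : ℝ := 1 / 10 ^ 11 / (1 + h / n ^ 2) with ht
  have ht0 : 0 < t := by positivity
  have ht1 : t ≤ 1 := by
    rw [ht, div_le_one hd]
    have : 0 ≤ h / n ^ 2 := by positivity
    norm_num; linarith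
  have htd : t * (1 + h / n ^ 2) = 1 / 10 ^ 11 := div_mul_cancel₀ _ hd.ne'
  have h1 := henergy (√t) (by positivity) (Real.sqrt_le_one.mpr ht1)
  rw [Real.sq_sqrt ht0.le] at h1
  have hr1 : √t ≤ 1 := Real.sqrt_le_one.mpr ht1
  have hlog : Real.log (3 / √t) ≤ 9 / t := by
    have h3 : 1 ≤ 3 / √t := by
      rw [le_div_iff₀ (by positivity)]; linarith
    calc Real.log (3 / √t) ≤ 3 / √t :=
          (Real.log_le_sub_one_of_pos (by positivity)).trans (by linarith)
      _ ≤ (3 / √t) ^ 2 := le_self_pow₀ h3 two_ne_zero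
      _ = 9 / t := by rw [div_pow, Real.sq_sqrt ht0.le]; norm_num
  have h4 : n ^ 2 * Real.log (3 / √t) ≤ 9 * 10 ^ 11 * (2 * κ) := by
    calc n ^ 2 * Real.log (3 / √t) ≤ n ^ 2 * (9 / t) := by gcongr
      _ = 9 * 10 ^ 11 * (n ^ 2 + h) := by
        rw [ht]; field_simp
      _ ≤ _ := by gcongr; linarith
  have h5 : 4 * m * t * (2 * 384 ^ 2 + 2 * h / n ^ 2) ≤ 8 * 384 ^ 2 / 10 ^ 11 * m := by
    calc 4 * m * t * (2 * 384 ^ 2 + 2 * h / n ^ 2)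
        ≤ 4 * m * t * (2 * 384 ^ 2 * (1 + h / n ^ 2)) := by
          have : 0 ≤ h / n ^ 2 := by positivity
          gcongr
          rw [mul_div_assoc]; linarith
      _ = 8 * 384 ^ 2 * m * (t * (1 + h / n ^ 2)) := by ring
      _ = _ := by rw [htd]; ring
  have hκ1 : 1 ≤ κ := hn2.trans hκ
  -- The constant `10²⁰` makes entropy, confidence and the two lost blocks negligible against `N/j`,
  -- so half of the rate `1/8192` survives. Then `16 · 16384 = 2¹⁸` is the final constant.
  have h6 : 1 / 16384 * (N / j) ≤ 16 / j * b := by norm_num at h1 h4 h5 hM1 hM2 ⊢; linarith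
  have h7 : 16 / j * b ≤ 16 / j * E := by gcongr
  have h8 := h6.trans h7
  rw [mul_div_assoc', div_mul_eq_mul_div 16, div_le_div_iff_of_pos_right hj] at h8
  norm_num at h8 ⊢
  linarith

end Numerics
end

/-! ### Assembly -/

noncomputable section

section Assembly

open scoped Matrix.Norms.L2Operator

variable {n : ℕ} [NeZero n] {L P S : Matrix (Fin n) (Fin n) ℝ} {ρ : ℝ}

/-- Similarity costs `‖S⁻¹‖ ‖S‖`, where `‖S⁻¹‖ ≤ 1` and `‖S‖² ≤ Tr P`; the term `n/(1 - ρ²)` merely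
enlarges the constant. -/
theorem norm_whiten_pow_le (hρ : 0 < ρ) (hρ1 : ρ < 1)
    (hL : spectralRadius ℂ (toComplexMatrix L) < ENNReal.ofReal ρ)
    (hP : L * P * Lᵀ - P + 1 = 0) (hS : S * Sᵀ = P) (hdet : IsUnit S.det) (j : ℕ) :
    ‖(S⁻¹ * L * S) ^ j‖ ≤ mixingConst L P ρ * ρ ^ j := by
  have hTR := whiten_mul_transpose_add hP hS hdet
  have hR : ‖S⁻¹‖ ≤ 1 := norm_le_one_of_mul_transpose_add (by rw [add_comm]; exact hTR)
  have hSn : ‖S‖ ≤ √(P.trace + n / (1 - ρ ^ 2)) := by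
    refine Real.le_sqrt_of_sq_le ((l2_opNorm_sq_le_trace S).trans ?_)
    rw [hS]
    have : 0 ≤ 1 - ρ ^ 2 := by nlinarith
    exact le_add_of_nonneg_right (by positivity)
  have hLj := norm_pow_le_hinfNorm hρ hL j
  have hh := one_le_hinfNorm hρ hL
  rw [whiten_pow hdet, mixingConst]
  calc ‖S⁻¹ * L ^ j * S‖ ≤ ‖S⁻¹‖ * ‖L ^ j‖ * ‖S‖ :=
        (norm_mul_le _ _).trans (mul_le_mul_of_nonneg_right (norm_mul_le _ _) (norm_nonneg _))
    _ ≤ 1 * (hinfNorm (resolventFun (ρ⁻¹ • L)) * ρ ^ j) * √(P.trace + n / (1 - ρ ^ 2)) := by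
        gcongr
    _ = _ := by ring

/-- Both terms under the root are at least `1`. With `N ≥ 2` this gives `ΓN/δ ≥ 2√2`, which keeps
the iterated logarithm positive. -/
theorem sqrt_two_le_mixingConst (hρ : 0 < ρ) (hρ1 : ρ < 1)
    (hL : spectralRadius ℂ (toComplexMatrix L) < ENNReal.ofReal ρ) (hP : 1 ≤ P.trace) :
    √2 ≤ mixingConst L P ρ := by
  have hn : (1 : ℝ) ≤ n := by exact_mod_cast Nat.one_le_iff_ne_zero.mpr (NeZero.ne n)
  have h1 : 1 ≤ n / (1 - ρ ^ 2) := by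
    rw [one_le_div (by nlinarith)]; nlinarith
  calc √2 = 1 * √2 := (one_mul _).symm
    _ ≤ _ := mul_le_mul (one_le_hinfNorm hρ hL) (Real.sqrt_le_sqrt (by linarith))
      (by positivity) (zero_le_one.trans (one_le_hinfNorm hρ hL))

theorem exists_whiten_block_length (hρ : 0 < ρ) (hρ1 : ρ < 1)
    (hL : spectralRadius ℂ (toComplexMatrix L) < ENNReal.ofReal ρ)
    (hP : L * P * Lᵀ - P + 1 = 0) (hS : S * Sᵀ = P) (hdet : IsUnit S.det)
    (hΓ : 1 ≤ mixingConst L P ρ) :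
    ∃ j : ℕ, 0 < j ∧ ‖euclideanCLM (S⁻¹ * L * S) ^ j‖ ≤ 1 / 2 ∧
      j * (1 - ρ) ≤ Real.log (2 * mixingConst L P ρ) + 1 ∧ j * (1 - ρ) ≤ 4 * (n : ℝ) ^ 2 := by
  obtain ⟨j, hj0, hj, hj1, hj2⟩ := exists_block_length (Nat.one_le_iff_ne_zero.mpr (NeZero.ne n))
    (f := fun j => ‖(S⁻¹ * L * S) ^ j‖) hρ hρ1 hΓ (norm_whiten_pow_le hρ hρ1 hL hP hS hdet)
    (fun m hm => norm_pow_mul_le_of_spectrum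
      (norm_le_one_of_mul_transpose_add (whiten_mul_transpose_add hP hS hdet))
      (fun z hz => norm_le_of_mem_spectrum_toComplexMatrix hρ hL (spectrum_whiten hdet ▸ hz)) hm)
  refine ⟨j, hj0, ?_, hj1, hj2⟩
  rw [← map_pow, norm_toEuclideanCLM]
  exact hj

end Assembly
end

theorem mainTheorem6 :
    ∃ C : ℝ, 0 < C ∧ ∃ c : ℝ, 0 < c ∧
      ∀ (n m : ℕ), 1 ≤ n →
      ∀ (A : Matrix (Fin n) (Fin n) ℝ) (B : Matrix (Fin n) (Fin m) ℝ)
        (K : Matrix (Fin m) (Fin n) ℝ) (L P : Matrix (Fin n) (Fin n) ℝ) (γ η δ ρ Γ : ℝ) (N : ℕ),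
      -- the closed-loop matrix, the discount factor and the confidence level
      L = A + B * K →
      0 < γ → γ < 1 → η = γ / (1 - γ) →
      0 < δ → δ < 1 →
      -- `ρ ∈ (ρ(L), 1)`; in particular the closed loop is stable
      spectralRadius ℂ (toComplexMatrix L) < ENNReal.ofReal ρ → ρ < 1 →
      -- `P` is the solution `P_∞` of the discrete-time Lyapunov equation
      L * P * Lᵀ - P + 1 = 0 →
      Γ = mixingConst L P ρ →
      -- the trajectory is long enough
      2 ≤ N →
      C * (max (P.trace ^ 2) (η ^ 2 * n) / ((1 - ρ) * lambdaMin P ^ 2)) ≤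
        N / (Real.log (Γ * N / δ) * Real.log (Real.log (Γ * N / δ))) →
      ∀ (Ω : Type*) [MeasurableSpace Ω] (μ : Measure Ω) [IsProbabilityMeasure μ]
        (W : ℕ → Ω → EuclideanSpace ℝ (Fin n)),
        (∀ k, HasLaw (W k) (stdGaussian (EuclideanSpace ℝ (Fin n))) μ) →
        iIndepFun W μ →
        ENNReal.ofReal (1 - δ) ≤
          μ {ω | c * (N * lambdaMin P ^ 2) ≤
            lambdaMin (featureGram η (lqrState A B K W) N ω)} := by
  refine ⟨10 ^ 20, by norm_num, 1 / 2 ^ 18, by norm_num, ?_⟩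
  intro n m hn A B K L P γ η δ ρ Γ N hLdef hγ hγ1 hη hδ hδ1 hL hρ1 hP hΓ hN hcond Ω _ μ _ W
    hlaw hind
  have : NeZero n := ⟨by omega⟩
  have hn' : (1 : ℝ) ≤ n := by exact_mod_cast hn
  have hρ : 0 < ρ := ENNReal.ofReal_pos.mp (bot_le.trans_lt hL)
  have hpow := tendsto_pow_of_spectralRadius_toComplexMatrix_lt
    (hL.trans (by rw [← ENNReal.ofReal_one]; exact (ENNReal.ofReal_lt_ofReal_iff one_pos).mpr hρ1))
  have hsymm := isSymm_of_lyapunov hpow hP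
  have hherm : P.IsHermitian := hsymm
  have hge := dotProduct_self_le_of_lyapunov hpow hP
  have hlam : 1 ≤ lambdaMin P := le_lambdaMin hherm fun x => by simpa using hge x
  have htr : n * lambdaMin P ≤ P.trace := by simpa using card_mul_lambdaMin_le_trace hherm
  set lam := lambdaMin P
  have hlam0 : 0 < lam := by linarith
  have hntr : (n : ℝ) ≤ P.trace := (le_mul_of_one_le_right (by positivity) hlam).trans htr
  obtain ⟨S, hS, hdet⟩ := exists_factorization hherm hge
  have hSv : ∀ v : Fin n → ℝ, lam * (v ⬝ᵥ v) ≤ (Sᵀ *ᵥ v) ⬝ᵥ (Sᵀ *ᵥ v) := fun v => by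
    have h := lambdaMin_mul_le hherm v
    rw [← hS, ← Matrix.mulVec_mulVec, Matrix.dotProduct_mulVec v S, ← Matrix.mulVec_transpose] at h
    rwa [hS] at h
  have hΓ2 := sqrt_two_le_mixingConst hρ hρ1 hL (hn'.trans hntr)
  have hΓ1 : 1 ≤ mixingConst L P ρ := (Real.one_le_sqrt.mpr (by norm_num)).trans hΓ2
  obtain ⟨j, hj0, hj, hj1, hj2⟩ := exists_whiten_block_length hρ hρ1 hL hP hS hdet hΓ1
  rw [← hΓ] at hΓ2 hj1
  have hj' : (0 : ℝ) < j := by exact_mod_cast hj0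
  -- The trace term dominates `n²` because `Tr P ≥ n λ_min(P)`; the other term dominates `‖H‖²`.
  set κ := max (P.trace ^ 2) (η ^ 2 * n) / lam ^ 2 with hκ
  have hκn : (n : ℝ) ^ 2 ≤ κ := by
    rw [hκ, le_div_iff₀ (by positivity), ← mul_pow]
    exact le_max_of_le_left (by gcongr)
  set H := matVec (η • (S⁻¹ * S⁻¹ᵀ)) with hH
  have hHκ : ‖H‖ ^ 2 ≤ κ := by
    rw [hκ, le_div_iff₀ (by positivity)]
    refine le_max_of_le_right ?_
    have h1 := frobSq_inv_mul_transpose_le hlam0.le hSv hdet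
    have h2 : ‖H‖ ^ 2 = η ^ 2 * frobSq (S⁻¹ * S⁻¹ᵀ) := by
      rw [hH, norm_matVec_sq]
      simp [frobSq, mul_pow, Finset.mul_sum]
    rw [Fintype.card_fin] at h1
    rw [h2]
    nlinarith [mul_le_mul_of_nonneg_left h1 (sq_nonneg η)]
  have hcond' : 10 ^ 20 * (κ / (1 - ρ)) ≤
      N / (Real.log (Γ * N / δ) * Real.log (Real.log (Γ * N / δ))) := by
    rwa [hκ, div_div, mul_comm (lam ^ 2)]
  obtain ⟨hM1, hM2, hs⟩ := number_of_blocks_bounds (by norm_num) hκn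
    (by positivity) hρ1 hδ hδ1 (by exact_mod_cast hN) hΓ2 rfl rfl hj' hj1 hj2 hcond'
  -- Natural-number division: the chain uses `⌊N/j⌋ - 1` blocks, since the first `j` times are
  -- skipped, and this bound makes the truncated subtraction genuine.
  have hN2 : 2 ≤ N / j := by
    have h1 : (2 : ℝ) ≤ N / j := by
      have : 1 ≤ κ := (one_le_pow₀ hn').trans hκn
      norm_num at hM1
      linarith
    rw [le_div_iff₀ hj'] at h1
    rw [Nat.le_div_iff_mul_le hj0]
    exact_mod_cast h1
  have hmN : (N / j - 1 + 1) * j ≤ N := by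
    rw [Nat.sub_add_cancel (by omega)]
    exact Nat.div_mul_le_self N j
  have hm1 : (N : ℝ) / j - 2 ≤ ((N / j - 1 : ℕ) : ℝ) := by
    rw [Nat.cast_sub (by omega), Nat.cast_one]
    have h1 : (N : ℝ) / j < (N / j : ℕ) + 1 := by
      rw [div_lt_iff₀ hj']
      rw [mul_comm]
      exact_mod_cast Nat.lt_mul_div_succ N hj0
    linarith
  refine (prob_blockSum_lower_bound hind hlaw
    (norm_sq_adjoint_add (whiten_mul_transpose_add hP hS hdet)) hj0 hj H (N / j - 1) hδ).trans ?_
  refine measure_mono fun ω hω => ?_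
  have hfin := le_lambdaMin_featureGram hdet hlam0 hSv η (X := lqrState A B K W) (N := N) (ω := ω)
    (b := 1 / 2 ^ 18 * N) (fun k ω => lqrState_eq_linState hdet W k ω) (by positivity) ?_
  · rw [Set.mem_ofPred_eq, ← mul_assoc]; exact hfin
  intro u hu hu1
  rw [← hLdef]
  refine energy_numerics hn' hκn hHκ (sq_nonneg _) hj' hM1 hM2 hs hm1 (Nat.cast_nonneg _)
    (blockSum_le_sum_Icc hj0 hmN fun k => sq_nonneg _) fun r hr hr1 => ?_
  simpa using hω u hu hu1 r hr hr1
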